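/- **Model.** Consider $n\ge 1$ parallel single-server queues in discrete time. In slot $t$, an integer number $A(t)\ge 0$ of jobs arrives and all of them join one queue, after which server $l$ serves up to an integer number $S_l(t)\ge 0$ of jobs: $Q_l(t+1)=[Q_l(t)+A(t)Z_l(t)-S_l(t)]^+$, where $Z(t)\in\{e_1,\dots,e_n\}$ is the dispatching action. The $A(t)$ are i.i.d. with mean $n\lambda$ and $A(t)\le nA_{\max}$ a.s.; the vectors $S(t)$ are i.i.d., independent of the arrivals, with mean $\boldsymbol\mu\in(0,\infty)^n$ and $S_l(t)\le S_{\max}$ a.s. A policy is given by an integer $T\ge 1$, a vector $\boldsymbol\gamma\in(0,\infty)^n$, a measurable sorting function $L$ and a measurable decision function $Y$. At each sampling time $kT$ a permutation $\eta_k=L\big((Q_l(kT)/\gamma_l)_l,V_k\big)$ of $\{1,\dots,n\}$ is chosen which lists the scaled queue lengths $Q_l(kT)/\gamma_l$ in decreasing order, and the actions in the slots $kT,\dots,(k+1)T-1$ are the $T$ components of $Y(\eta_k,\boldsymbol\mu,W_k)\in\{e_1,\dots,e_n\}^T$; here $(V_k)$, $(W_k)$ are i.i.d. uniform on $[0,1]$,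 independent of each other and of the arrivals and services. Let $f_{l,\eta}$ and $\tau^2_{l,\eta}$ be the mean and the variance, given that the permutation is $\eta$, of the fraction of the $T$ slots of a cycle in which the arrivals are sent to server $\eta(l)$, and let $\mathcal F=(\mathbf f_\eta,\boldsymbol\tau^2_\eta)_\eta$. Put $\epsilon=\sum_l\mu_l-n\lambda$. For a steady-state distribution of the queue lengths $\mathbf Q$ at the sampling times, let $\mathbf O=(Q_l/\sqrt{\gamma_l})_l$ and let $$\mathbf O_\perp=\mathbf O-\frac{\langle \mathbf c,\mathbf O\rangle}{\langle \mathbf c,\mathbf c\rangle}\mathbf c,\qquad \mathbf c=(\sqrt{\gamma_l})_l .$$ **Theorem 3 (state-space collapse).** There is a real-valued function $N_\perp=N_\perp(n,T,\boldsymbol\gamma,\mathcal F;\boldsymbol\mu,A_{\max},S_{\max})$, not depending on $\epsilon$, with the following two properties. (1) Let $n,T\ge1$, a policy, $\boldsymbol\mu$, $A_{\max}$ and $S_{\max}$ be such that $$\sum_{l=1}^m f_{l,\eta}<\frac{\sum_{l=1}^m\mu_{\eta(l)}}{\sum_{l=1}^n\mu_{\eta(l)}}\qquad\text{for all } 1\le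 m<n \text{ and all permutations } \eta .$$ Then there is $\epsilon_0>0$ such that, for all arrival and service laws as above with $0<\epsilon<\epsilon_0$, a steady-state distribution exists, and every steady-state distribution satisfies $$\mathbb E\big[\|\mathbf O_\perp\|_2^2\big]\le N_\perp^2 .$$ (2) $N_\perp\in\Theta(Tn^4)$ in the following sense: for all positive constants $\gamma_0,\gamma_1,\mu_0,\mu_1,\theta,A_{\max},S_{\max}$ there are $c,C>0$ with $$c\,Tn^4\le N_\perp\le C\,Tn^4$$ for all $n,T\ge 1$ and all policies and rates with $\gamma_l\in[\gamma_0,\gamma_1]$, $\mu_l\in[\mu_0,\mu_1]$ for every $l$, and $\sum_{l\le m}f_{l,\eta}+\theta/n\le\sum_{l\le m}\mu_{\eta(l)}/\sum_{l\le n}\mu_{\eta(l)}$ for all $1\le m<n$ and all $\eta$. -/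

import Mathlib

open MeasureTheory ProbabilityTheory
open scoped BigOperators

namespace LoadBalancing

/-- A dispatching policy for `n` parallel queues whose queue lengths are sampled every `T` slots.
* `γ` is the vector of positive scaling factors;
* `sort o v` is the permutation chosen when the vector of scaled queue lengths is `o` and the
  uniform randomization variable is `v`: position `i` (position `0` = longest) is taken by server
  `sort o v i`, so that the scaled queue lengths are decreasing along the positions;
* `dispatch η μ w t` is the server to which all arrivals of the `t`-th slot of the cycle are sent
  when the permutation is `η`, the service rates are `μ` and the uniform randomization variable
  is `w`. -/
structure Policy (n T : ℕ) where
  γ : Fin n → ℝ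
  γ_pos : ∀ l, 0 < γ l
  sort : (Fin n → ℝ) → unitInterval → Equiv.Perm (Fin n)
  sort_measurable : ∀ (o : Fin n → ℝ) (η : Equiv.Perm (Fin n)), MeasurableSet {v | sort o v = η}
  sort_antitone : ∀ (o : Fin n → ℝ) (v : unitInterval), (∀ l, 0 ≤ o l) →
    Antitone fun i => o (sort o v i)
  dispatch : Equiv.Perm (Fin n) → (Fin n → ℝ) → unitInterval → Fin T → Fin n
  dispatch_measurable : ∀ (η : Equiv.Perm (Fin n)) (μ : Fin n → ℝ), (∀ l, 0 < μ l) →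
    Measurable (dispatch η μ)

/-- The fraction of the slots of a cycle with permutation `η` whose arrivals are sent to the
server in position `l`, as a function of the randomization variable `w`. -/
noncomputable def Policy.frac {n T : ℕ} (P : Policy n T) (μ : Fin n → ℝ) (η : Equiv.Perm (Fin n)) (l : Fin n)
    (w : unitInterval) : ℝ :=
  (∑ t : Fin T, if P.dispatch η μ w t = η l then (1 : ℝ) else 0) / T

/-- `f_{l,η}`: the expected fraction of slots sent to position `l` when the permutation is `η`. -/
noncomputable def Policy.f {n T : ℕ} (P : Policy n T) (μ : Fin n → ℝ) (η : Equiv.Perm (Fin n)) (l : Fin n) : ℝ :=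
  ∫ w, P.frac μ η l w

/-- `τ²_{l,η}`: the variance of the fraction of slots sent to position `l` when the permutation
is `η`. -/
noncomputable def Policy.τsq {n T : ℕ} (P : Policy n T) (μ : Fin n → ℝ) (η : Equiv.Perm (Fin n)) (l : Fin n) : ℝ :=
  variance (P.frac μ η l) volume

/-- The family `(f_η, τ²_η)`, indexed by the permutations `η`. -/
noncomputable def Policy.F {n T : ℕ} (P : Policy n T) (μ : Fin n → ℝ) (η : Equiv.Perm (Fin n)) :
    (Fin n → ℝ) × (Fin n → ℝ) :=
  (P.f μ η, P.τsq μ η)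

/-- The sum of the first `m` coordinates. -/
noncomputable def partialSum {n : ℕ} (x : Fin n → ℝ) (m : ℕ) : ℝ :=
  ∑ l : Fin n with l.val < m, x l

/-- The strict majorization condition. -/
def Policy.StrictMajorization {n T : ℕ} (P : Policy n T) (μ : Fin n → ℝ) : Prop :=
  ∀ (η : Equiv.Perm (Fin n)) (m : ℕ), 1 ≤ m → m < n →
    partialSum (P.f μ η) m < partialSum (fun l => μ (η l)) m / ∑ l, μ (η l)

/-- The strict majorization condition holds with slack at least `δ`. -/
def Policy.MajorizationSlack {n T : ℕ} (P : Policy n T) (μ : Fin n → ℝ) (δ : ℝ) : Prop :=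
  ∀ (η : Equiv.Perm (Fin n)) (m : ℕ), 1 ≤ m → m < n →
    partialSum (P.f μ η) m + δ ≤ partialSum (fun l => μ (η l)) m / ∑ l, μ (η l)

/-- `α` is the law of the number of jobs arriving in a slot: mean `n * lam`, bounded by
`n * Amax`. -/
structure IsArrivalLaw (n : ℕ) (lam Amax : ℝ) (α : Measure ℕ) : Prop where
  isProb : IsProbabilityMeasure α
  le_max : ∀ᵐ a : ℕ ∂α, (a : ℝ) ≤ n * Amax
  mean : ∫ a : ℕ, (a : ℝ) ∂α = n * lam

/-- `σ` is the (joint) law of the potential services of the `n` servers in a slot: mean vector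
`μ`, each coordinate bounded by `Smax`. -/
structure IsServiceLaw {n : ℕ} (μ : Fin n → ℝ) (Smax : ℝ) (σ : Measure (Fin n → ℕ)) : Prop where
  isProb : IsProbabilityMeasure σ
  le_max : ∀ᵐ s : Fin n → ℕ ∂σ, ∀ l, (s l : ℝ) ≤ Smax
  mean : ∀ l, ∫ s : Fin n → ℕ, (s l : ℝ) ∂σ = μ l

/-- One slot of the queue dynamics, `[Q + A Z - S]⁺`: the `a` arriving jobs join queue `j`, then
every server `l` serves up to `s l` jobs (the subtraction of natural numbers is truncated). -/
def slotStep {n : ℕ} (j : Fin n) (a : ℕ) (s : Fin n → ℕ) (q : Fin n → ℕ) : Fin n → ℕ :=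
  fun l => (q l + if l = j then a else 0) - s l

/-- The randomness of one cycle: the randomization variables of the sorting function and of the
decision function, the arrivals and the potential services of the `T` slots. -/
abbrev CycleNoise (n T : ℕ) : Type :=
  unitInterval × unitInterval × (Fin T → ℕ) × (Fin T → Fin n → ℕ)

/-- The law of the randomness of one cycle: two uniform variables, i.i.d. arrivals and i.i.d.
potential services, all independent. -/
noncomputable def cycleNoise {n : ℕ} (T : ℕ) (α : Measure ℕ) (σ : Measure (Fin n → ℕ)) : Measure (CycleNoise n T) :=
  (volume : Measure unitInterval).prod ((volume : Measure unitInterval).prod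
    ((Measure.pi fun _ : Fin T => α).prod (Measure.pi fun _ : Fin T => σ)))

/-- The queue lengths at the next sampling time, from the queue lengths `q` at a sampling time and
the randomness of the cycle. -/
noncomputable def Policy.cycleStep {n T : ℕ} (P : Policy n T) (μ : Fin n → ℝ) (q : Fin n → ℕ) (ω : CycleNoise n T) :
    Fin n → ℕ :=
  Fin.foldl T
    (fun x t =>
      slotStep (P.dispatch (P.sort (fun l => (q l : ℝ) / P.γ l) ω.1) μ ω.2.1 t)
        (ω.2.2.1 t) (ω.2.2.2 t) x) q

/-- The transition kernel of the Markov chain of the queue lengths at the sampling times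
`0, T, 2T, …`. -/
noncomputable def Policy.sampledChain {n T : ℕ} (P : Policy n T) (μ : Fin n → ℝ) (α : Measure ℕ)
    (σ : Measure (Fin n → ℕ)) : Kernel (Fin n → ℕ) (Fin n → ℕ) :=
  Kernel.ofFunOfCountable fun q => (cycleNoise T α σ).map (P.cycleStep μ q)

/-- `π` is a steady-state distribution of the queue lengths at the sampling times. -/
def Policy.IsSteadyState {n T : ℕ} (P : Policy n T) (μ : Fin n → ℝ) (α : Measure ℕ)
    (σ : Measure (Fin n → ℕ)) (π : Measure (Fin n → ℕ)) : Prop :=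
  IsProbabilityMeasure π ∧ Kernel.Invariant (P.sampledChain μ α σ) π

/-- The scaled queue length vector `O = (Q_l / √γ_l)`. -/
noncomputable def scaledQueue {n : ℕ} (γ : Fin n → ℝ) (q : Fin n → ℕ) : EuclideanSpace ℝ (Fin n) :=
  WithLp.toLp 2 fun l => (q l : ℝ) / √(γ l)

/-- The direction `c = (√γ_l)`. -/
noncomputable def collapseDir {n : ℕ} (γ : Fin n → ℝ) : EuclideanSpace ℝ (Fin n) :=
  WithLp.toLp 2 fun l => √(γ l)

/-- The projection of `O` on the line spanned by `c`. -/
noncomputable def parallelPart {n : ℕ} (γ : Fin n → ℝ) (q : Fin n → ℕ) : EuclideanSpace ℝ (Fin n) :=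
  (inner ℝ (collapseDir γ) (scaledQueue γ q) / inner ℝ (collapseDir γ) (collapseDir γ)) •
    collapseDir γ

/-- The component of `O` perpendicular to `c`. -/
noncomputable def perpPart {n : ℕ} (γ : Fin n → ℝ) (q : Fin n → ℕ) : EuclideanSpace ℝ (Fin n) :=
  scaledQueue γ q - parallelPart γ q

end LoadBalancing

/-! The proof is a Lyapunov drift argument over one sampling cycle. Write `x_l = Q_l / γ_l`, let
`hi` and `lo` be the largest and smallest `x_l`, `M = ∑ μ_l`, `ε = M - nλ`, and let `δ` be
`majorizationGap`. Given the permutation, position `i` has mean net input `T(nλ f_i - μ_{η(i)})`.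
The weights `x` decrease along `η`, so Abel summation and the majorization slack bound the mean of
`∑ x_l · netInput_l` by `T(-δM(hi - lo) - ε lo)` (`Policy.sum_mul_f_sub_le`,
`Policy.integral_sum_mul_netInput_le`).

With `∑ x_l² γ_l` as Lyapunov function, this drift and Foster's criterion give a steady state for
every `ε > 0`. For collapse, `x` is centred at its weighted mean. If `ε ≤ δM/2`, half of the
negative drift survives, and since `‖O_⊥‖ ≤ (∑ √γ_l)(hi - lo)` the drift of `‖O_⊥‖²` is at most `K -
2κ‖O_⊥‖`, where `K` is `noiseBound` and `κ` is `collapseRate`. Passing to `‖O_⊥‖³` turns this into a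
second moment bound: `E‖O_⊥‖² ≤ (√K + K/κ)²`, for every invariant law.

The witness `N_⊥` is `√K + K/κ`. In the regime of part (2), `K` has order `T²n³` and `κ` has order
`T/n`, so `K/κ` has order `Tn⁴` and dominates. The exponent 4 belongs to this explicit bound, whose
estimates are deliberately coarse. -/

section MarkovChain

/-! ### Drift criteria for Markov chains on a countable space. -/

open Filter Topology ENNReal

/-- Moment bound from a drift condition: the stationary mean of the drift is at most the constant,
without any integrability of the Lyapunov function. -/
theorem lintegral_le_of_drift_of_invariant {S : Type*} [Countable S] [MeasurableSpace S]
    [MeasurableSingletonClass S] (κ : Kernel S S) [IsMarkovKernel κ] (V f : S → ℝ≥0∞) (b : ℝ≥0∞)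
    (hV : ∀ x, V x ≠ ∞) (hdrift : ∀ x, ∫⁻ y, V y ∂(κ x) + f x ≤ V x + b)
    (π : Measure S) [IsProbabilityMeasure π] (hπ : Kernel.Invariant κ π) :
    ∫⁻ x, f x ∂π ≤ b := by
  -- `min V k` has a finite stationary mean, which cancels by invariance. Where `V > k` the
  -- truncation is already maximal, so it cannot increase and the indicator drops `f` there.
  have trunc (k : ℕ) : ∫⁻ x, {x | V x ≤ k}.indicator f x ∂π ≤ b := by
    have h (x : S) : ∫⁻ y, min (V y) k ∂(κ x) + {x | V x ≤ k}.indicator f x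
        ≤ min (V x) k + b := by
      by_cases hx : V x ≤ k
      · rw [Set.indicator_of_mem (by exact hx), min_eq_left hx]
        exact (add_le_add_left (lintegral_mono fun y => min_le_left _ _) _).trans (hdrift x)
      · rw [Set.indicator_of_notMem (by exact hx), min_eq_right (not_le.1 hx).le, add_zero]
        refine (lintegral_mono fun y => min_le_right (V y) (k : ℝ≥0∞)).trans ?_
        simp
    have hint := lintegral_mono (μ := π) h
    rw [lintegral_add_right _ (.of_discrete), lintegral_add_right _ (.of_discrete),
      ← Measure.lintegral_bind (m := π) (μ := κ) (f := fun y => min (V y) (k : ℝ≥0∞))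
        κ.measurable.aemeasurable (Measurable.of_discrete).aemeasurable,
      hπ.def, lintegral_const, measure_univ, mul_one] at hint
    refine (ENNReal.add_le_add_iff_left ?_).1 hint
    refine ne_top_of_le_ne_top (ENNReal.natCast_ne_top k)
      ((lintegral_mono fun y => min_le_right (V y) (k : ℝ≥0∞)).trans ?_)
    simp
  -- As `V` is finite everywhere, its sublevel sets exhaust the space.
  have hsup (x : S) : f x = ⨆ k : ℕ, {x | V x ≤ k}.indicator f x := by
    refine le_antisymm ?_ (iSup_le fun k => Set.indicator_le_self _ _ _)
    obtain ⟨k, hk⟩ := ENNReal.exists_nat_gt (hV x)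
    refine le_iSup_of_le k ?_
    rw [Set.indicator_of_mem (by exact hk.le)]
  calc ∫⁻ x, f x ∂π = ∫⁻ x, ⨆ k : ℕ, {x | V x ≤ k}.indicator f x ∂π := by simp_rw [← hsup]
    _ = ⨆ k : ℕ, ∫⁻ x, {x | V x ≤ k}.indicator f x ∂π := by
      refine lintegral_iSup (fun k => .of_discrete) fun k l hkl => ?_
      refine Set.indicator_le_indicator_of_subset (fun x hx => ?_) (fun _ => zero_le)
      exact (show V x ≤ k from hx).trans (by exact_mod_cast hkl)
    _ ≤ b := iSup_le trunc

/-- The drift condition summed along the laws of a trajectory of the chain. -/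
theorem lintegral_add_sum_le_of_drift {S : Type*} [Countable S] [MeasurableSpace S]
    [MeasurableSingletonClass S] (κ : Kernel S S) (V f : S → ℝ≥0∞)
    (b : ℝ≥0∞) (hdrift : ∀ x, ∫⁻ y, V y ∂(κ x) + f x ≤ V x + b) (ν : ℕ → Measure S)
    (hprob : ∀ k, IsProbabilityMeasure (ν k)) (hν : ∀ k, ν (k + 1) = (ν k).bind κ) (N : ℕ) :
    ∫⁻ x, V x ∂(ν N) + ∑ k ∈ Finset.range N, ∫⁻ x, f x ∂(ν k) ≤ ∫⁻ x, V x ∂(ν 0) + N * b := by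
  induction N with
  | zero => simp
  | succ N ih =>
    have h := lintegral_mono (μ := ν N) hdrift
    rw [lintegral_add_right _ (.of_discrete), lintegral_add_right _ (.of_discrete),
      ← Measure.lintegral_bind (m := ν N) (μ := κ) κ.measurable.aemeasurable
        (Measurable.of_discrete).aemeasurable, ← hν, lintegral_const, measure_univ, mul_one] at h
    rw [Finset.sum_range_succ]
    calc _ = (∫⁻ x, V x ∂(ν (N + 1)) + ∫⁻ x, f x ∂(ν N))
          + ∑ k ∈ Finset.range N, ∫⁻ x, f x ∂(ν k) := by ring
      _ ≤ (∫⁻ x, V x ∂(ν N) + b) + ∑ k ∈ Finset.range N, ∫⁻ x, f x ∂(ν k) := by gcongr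
      _ = (∫⁻ x, V x ∂(ν N) + ∑ k ∈ Finset.range N, ∫⁻ x, f x ∂(ν k)) + b := by ring
      _ ≤ (∫⁻ x, V x ∂(ν 0) + N * b) + b := by gcongr
      _ = _ := by push_cast; ring

/-- Foster's criterion: a drift condition with a drift function that has finite sublevel sets
gives an invariant distribution. -/
theorem exists_invariant_of_drift {S : Type*} [Countable S] [Nonempty S] [MeasurableSpace S]
    [MeasurableSingletonClass S] (κ : Kernel S S) [IsMarkovKernel κ] (V f : S → ℝ≥0∞) (b : ℝ≥0∞)
    (hV : ∀ x, V x ≠ ∞) (hb : b ≠ ∞) (hdrift : ∀ x, ∫⁻ y, V y ∂(κ x) + f x ≤ V x + b)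
    (hfin : ∀ R : ℝ≥0∞, R ≠ ∞ → {x | f x ≤ R}.Finite) :
    ∃ π : Measure S, IsProbabilityMeasure π ∧ Kernel.Invariant κ π := by
  classical
  obtain ⟨x₀⟩ := ‹Nonempty S›
  obtain ⟨ν, hν0, hν⟩ : ∃ ν : ℕ → Measure S, ν 0 = Measure.dirac x₀ ∧
      ∀ k, ν (k + 1) = (ν k).bind κ :=
    ⟨fun k => Nat.rec (Measure.dirac x₀) (fun _ m => m.bind κ) k, rfl, fun _ => rfl⟩
  have hprob (k : ℕ) : IsProbabilityMeasure (ν k) := by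
    induction k with
    | zero => rw [hν0]; infer_instance
    | succ k ih => rw [hν]; infer_instance
  -- the Cesàro averages of the laws
  let A : ℕ → Set S → ℝ≥0∞ := fun N s => (∑ k ∈ Finset.range N, ν k s) / N
  have hA (N : ℕ) (hN : N ≠ 0) (s : Finset S) : A N s = ∑ x ∈ s, A N {x} := by
    simp only [A]
    simp_rw [div_eq_mul_inv, ← Finset.sum_mul]
    rw [Finset.sum_comm]
    simp
  have hAle (N : ℕ) (s : Set S) : A N s ≤ 1 := by
    refine ENNReal.div_le_of_le_mul ?_
    calc ∑ k ∈ Finset.range N, ν k s ≤ ∑ k ∈ Finset.range N, 1 :=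
          Finset.sum_le_sum fun k _ => by have := hprob k; exact prob_le_one
      _ = 1 * N := by simp
  -- An ultrafilter gives limits at all points simultaneously, since `ℝ≥0∞` is compact; no diagonal
  -- subsequence is needed.
  let U : Ultrafilter ℕ := hyperfilter ℕ
  have hU : (U : Filter ℕ) ≤ atTop := Nat.hyperfilter_le_atTop
  have hne : ∀ᶠ N in (U : Filter ℕ), N ≠ 0 := hU (eventually_ne_atTop 0)
  have hlim (x : S) : ∃ p : ℝ≥0∞, Tendsto (fun N => A N {x}) U (𝓝 p) := by
    obtain ⟨p, -, hp⟩ := (isCompact_univ (X := ℝ≥0∞)).ultrafilter_le_nhds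
      (U.map fun N => A N {x}) (by simp)
    exact ⟨p, hp⟩
  choose p hp using hlim
  have hpsum (s : Finset S) : Tendsto (fun N => A N s) U (𝓝 (∑ x ∈ s, p x)) := by
    refine Tendsto.congr' ?_ (tendsto_finsetSum s fun x _ => hp x)
    filter_upwards [hne] with N hN
    rw [hA N hN]
  have hple : ∑' x, p x ≤ 1 := by
    rw [ENNReal.tsum_eq_iSup_sum]
    exact iSup_le fun s => le_of_tendsto' (hpsum s) fun N => hAle N s
  -- Tightness: the summed drift bounds the time average of the mean of `f`, and Markov's inequality
  -- bounds the mass where `f > R` uniformly in `N`.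
  have htight (N : ℕ) (hN : N ≠ 0) (R : ℝ≥0∞) (hR0 : R ≠ 0) (hR : R ≠ ∞) :
      1 ≤ A N {x | f x ≤ R} + (V x₀ + b) / R := by
    have hN' : (N : ℝ≥0∞) ≠ 0 := by exact_mod_cast hN
    have h1 := lintegral_add_sum_le_of_drift κ V f b hdrift ν hprob hν N
    have h0 : ∫⁻ x, V x ∂(ν 0) = V x₀ := by rw [hν0, lintegral_dirac]
    rw [h0] at h1
    have h2 : ∑ k ∈ Finset.range N, ν k {x | f x ≤ R}ᶜ ≤ (V x₀ + N * b) / R := by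
      rw [ENNReal.le_div_iff_mul_le (Or.inl hR0) (Or.inl hR), Finset.sum_mul]
      refine le_trans (Finset.sum_le_sum fun k _ => ?_) (le_trans le_add_self h1)
      rw [mul_comm]
      refine le_trans ?_ (mul_meas_ge_le_lintegral₀ (Measurable.of_discrete).aemeasurable R)
      gcongr
      intro x hx
      exact (not_le.1 (show ¬ f x ≤ R from hx)).le
    have h3 : (N : ℝ≥0∞) ≤ (∑ k ∈ Finset.range N, ν k {x | f x ≤ R}) + (V x₀ + N * b) / R := by
      calc (N : ℝ≥0∞) = ∑ k ∈ Finset.range N, (ν k {x | f x ≤ R} + ν k {x | f x ≤ R}ᶜ) := by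
            simp_rw [fun k => prob_add_prob_compl (μ := ν k) (s := {x | f x ≤ R})
              (MeasurableSet.of_discrete)]
            simp
        _ ≤ _ := by rw [Finset.sum_add_distrib]; gcongr
    calc (1 : ℝ≥0∞) = N / N := (ENNReal.div_self hN' (ENNReal.natCast_ne_top N)).symm
      _ ≤ ((∑ k ∈ Finset.range N, ν k {x | f x ≤ R}) + (V x₀ + N * b) / R) / N := by gcongr
      _ = A N {x | f x ≤ R} + (V x₀ + N * b) / R / N := by rw [ENNReal.add_div]
      _ ≤ A N {x | f x ≤ R} + (V x₀ + b) / R := by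
        refine add_le_add le_rfl (ENNReal.div_le_of_le_mul ?_)
        rw [ENNReal.div_eq_inv_mul, ENNReal.div_eq_inv_mul, mul_assoc]
        gcongr
        rw [add_mul, mul_comm b]
        gcongr
        exact le_mul_of_one_le_right zero_le (by exact_mod_cast Nat.one_le_iff_ne_zero.2 hN)
  -- Sublevel sets of `f` are finite, so their mass passes to the limit; letting `R → ∞` shows that
  -- no mass escapes.
  have hge : 1 ≤ ∑' x, p x := by
    have hR (R : ℕ) (hR : R ≠ 0) : 1 ≤ ∑' x, p x + (V x₀ + b) / R := by
      have hF := hfin R (ENNReal.natCast_ne_top R)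
      have h := (hpsum hF.toFinset).add_const ((V x₀ + b) / R)
      rw [hF.coe_toFinset] at h
      refine le_trans (ge_of_tendsto h ?_) (add_le_add_left (ENNReal.sum_le_tsum _) _)
      filter_upwards [hne] with N hN
      exact htight N hN R (by exact_mod_cast hR) (ENNReal.natCast_ne_top R)
    have hC : V x₀ + b ≠ ∞ := ENNReal.add_ne_top.2 ⟨hV x₀, hb⟩
    have ht : Tendsto (fun R : ℕ => ∑' x, p x + (V x₀ + b) / R) atTop (𝓝 (∑' x, p x + 0)) := by
      refine Tendsto.const_add _ ?_
      have := ENNReal.Tendsto.const_mul (a := V x₀ + b) ENNReal.tendsto_inv_nat_nhds_zero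
        (Or.inr hC)
      simpa [div_eq_mul_inv] using this
    rw [add_zero] at ht
    refine ge_of_tendsto ht ?_
    filter_upwards [eventually_ne_atTop 0] with R hR0 using hR R hR0
  let π : Measure S := Measure.sum fun x => p x • Measure.dirac x
  have hπ1 (x : S) : π {x} = p x := by
    simp only [π, Measure.sum_apply _ (MeasurableSet.singleton x), Measure.smul_apply,
      smul_eq_mul]
    rw [tsum_eq_single x]
    · simp
    · intro y hy
      simp [hy]
  have hπp : IsProbabilityMeasure π := by
    constructor
    simp only [π, Measure.sum_apply _ MeasurableSet.univ, Measure.smul_apply, smul_eq_mul]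
    simpa using le_antisymm hple hge
  refine ⟨π, hπp, ?_⟩
  -- Shifting time by one step changes a Cesàro average by at most `1 / N`.
  have hstep (N : ℕ) (s : S) : (∑ k ∈ Finset.range N, ν (k + 1) {s}) / N ≤ A N {s} + 1 / N := by
    rw [← ENNReal.add_div]
    refine ENNReal.div_le_div_right ?_ _
    have := Finset.sum_range_succ' (fun k => ν k {s}) N
    have h2 := Finset.sum_range_succ (fun k => ν k {s}) N
    calc _ ≤ ∑ k ∈ Finset.range N, ν (k + 1) {s} + ν 0 {s} := le_self_add
      _ = ∑ k ∈ Finset.range N, ν k {s} + ν N {s} := by rw [← this, h2]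
      _ ≤ _ := by gcongr; exact prob_le_one
  -- Only finite sums over source states pass to the limit, which yields `π κ ≤ π`. Equality follows
  -- because both are probability measures.
  have hfinite (F : Finset S) (s : S) : ∑ x ∈ F, p x * κ x {s} ≤ p s := by
    have h1 : Tendsto (fun N => ∑ x ∈ F, A N {x} * κ x {s}) U (𝓝 (∑ x ∈ F, p x * κ x {s})) :=
      tendsto_finsetSum F fun x _ =>
        ENNReal.Tendsto.mul_const (hp x) (Or.inr (measure_ne_top _ _))
    have h2 : Tendsto (fun N : ℕ => A N {s} + 1 / N) U (𝓝 (p s + 0)) := by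
      refine (hp s).add ?_
      simpa using ENNReal.tendsto_inv_nat_nhds_zero.mono_left hU
    rw [add_zero] at h2
    refine le_of_tendsto_of_tendsto' h1 h2 fun N => le_trans ?_ (hstep N s)
    simp only [A, div_eq_mul_inv]
    simp_rw [mul_right_comm _ _ (κ _ _), ← Finset.sum_mul]
    gcongr
    simp_rw [Finset.sum_mul]
    rw [Finset.sum_comm]
    refine Finset.sum_le_sum fun k _ => ?_
    rw [hν, Measure.bind_apply (MeasurableSet.singleton s) κ.measurable.aemeasurable,
      lintegral_countable']
    simp_rw [mul_comm (ν k _)]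
    exact ENNReal.sum_le_tsum F
  have hle : π.bind κ ≤ π := by
    have hsing (s : S) : (π.bind κ) {s} ≤ π {s} := by
      rw [Measure.bind_apply (MeasurableSet.singleton s) κ.measurable.aemeasurable,
        lintegral_countable', ENNReal.tsum_eq_iSup_sum]
      refine iSup_le fun F => ?_
      simp_rw [hπ1, mul_comm (κ _ _)]
      exact hfinite F s
    refine Measure.le_iff.2 fun s _ => ?_
    rw [← Measure.tsum_indicator_apply_singleton _ s (.of_discrete),
      ← Measure.tsum_indicator_apply_singleton _ s (.of_discrete)]
    exact ENNReal.tsum_le_tsum fun x => Set.indicator_le_indicator (hsing x)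
  exact Measure.eq_of_le_of_isProbabilityMeasure hle

end MarkovChain

/-! ### Abel summation. -/

section Abel

/-- Abel summation: pairing a decreasing vector with a vector whose proper partial sums are at most
`-δ` and whose total sum is zero. -/
theorem sum_mul_le_of_partialSum_le {k : ℕ} (z d : Fin (k + 1) → ℝ) (δ : ℝ) (hz : Antitone z)
    (hd : ∀ m, 1 ≤ m → m < k + 1 → LoadBalancing.partialSum d m ≤ -δ) :
    ∑ i, z i * d i ≤ -δ * (z 0 - z (Fin.last k)) + z (Fin.last k) * ∑ i, d i := by
  -- The total of `d` is left free because dropping the last coordinate would destroy a zero-sum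
  -- hypothesis.
  induction k with
  | zero => simp
  | succ k ih =>
    have hps (m : ℕ) (hm : m < k + 2) : LoadBalancing.partialSum d m
        = LoadBalancing.partialSum (fun i : Fin (k + 1) => d i.castSucc) m := by
      simp only [LoadBalancing.partialSum, Finset.sum_filter]
      rw [Fin.sum_univ_castSucc]
      simp only [Fin.val_castSucc, Fin.val_last, add_eq_left, ite_eq_right_iff]
      intro h
      omega
    have htot : LoadBalancing.partialSum (fun i : Fin (k + 1) => d i.castSucc) (k + 1)
        = ∑ i : Fin (k + 1), d i.castSucc := by
      simp only [LoadBalancing.partialSum]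
      rw [Finset.filter_true_of_mem fun i _ => i.isLt]
    have h1 := ih (fun i => z i.castSucc) (fun i => d i.castSucc)
      (fun i j hij => hz (by simpa using hij))
      (fun m hm1 hm2 => by rw [← hps m (by omega)]; exact hd m hm1 (by omega))
    -- The total of the shortened vector is a proper partial sum of `d`, hence at most `-δ`;
    -- multiplied by the last decrement of `z`, it supplies the missing part of the bound.
    have h2 : ∑ i : Fin (k + 1), d i.castSucc ≤ -δ := by
      rw [← htot, ← hps _ (by omega)]
      exact hd _ (by omega) (by omega)
    have h3 : z (Fin.last (k + 1)) ≤ z (Fin.last k).castSucc := hz (Fin.le_last _)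
    rw [Fin.sum_univ_castSucc, Fin.sum_univ_castSucc (f := d)]
    simp only [Fin.castSucc_zero] at h1
    nlinarith [mul_le_mul_of_nonneg_left h2 (sub_nonneg.2 h3)]

end Abel

namespace LoadBalancing

/-! ### Pathwise bounds for one cycle. -/

section Slots

variable {n T : ℕ}

/-- The number of jobs that join queue `l` during a cycle. -/
def cycleArrivals (j : Fin T → Fin n) (a : Fin T → ℕ) (l : Fin n) : ℕ :=
  ∑ t, if l = j t then a t else 0

/-- The potential service of server `l` during a cycle. -/
def cycleServices (s : Fin T → Fin n → ℕ) (l : Fin n) : ℕ := ∑ t, s t l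

/-- Truncation can only raise a queue. If it never acts, the balance is exact; if it acts, the queue
is emptied at that slot and afterwards holds at most the cycle's arrivals. -/
theorem foldl_slotStep_bounds (j : Fin T → Fin n) (a : Fin T → ℕ) (s : Fin T → Fin n → ℕ)
    (q : Fin n → ℕ) (l : Fin n) :
    q l + cycleArrivals j a l
        ≤ Fin.foldl T (fun x t => slotStep (j t) (a t) (s t) x) q l + cycleServices s l ∧
      (Fin.foldl T (fun x t => slotStep (j t) (a t) (s t) x) q l + cycleServices s l
          ≤ q l + cycleArrivals j a l ∨
        Fin.foldl T (fun x t => slotStep (j t) (a t) (s t) x) q l ≤ cycleArrivals j a l) := by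
  induction T with
  | zero => simp [cycleArrivals, cycleServices]
  | succ T ih =>
    have h := ih (fun t => j t.castSucc) (fun t => a t.castSucc) (fun t => s t.castSucc)
    rw [Fin.foldl_succ_last]
    simp only [cycleArrivals, cycleServices, Fin.sum_univ_castSucc] at h ⊢
    simp only [slotStep]
    split_ifs <;> omega

theorem sum_cycleArrivals (j : Fin T → Fin n) (a : Fin T → ℕ) :
    ∑ l, cycleArrivals j a l = ∑ t, a t := by
  simp only [cycleArrivals]
  rw [Finset.sum_comm]
  simp

/-- The net input `arrivals - potential services` of queue `l` during a cycle. -/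
def netInput (j : Fin T → Fin n) (a : Fin T → ℕ) (s : Fin T → Fin n → ℕ) (l : Fin n) : ℝ :=
  cycleArrivals j a l - cycleServices s l

/-- Without truncation this is the expansion of `(q + A - S)²`. With it, `q'² ≤ A²`, and the second
copy of `A²` makes the right side large enough because `(q + A - S)² ≥ 0`. -/
theorem sq_le_of_bounds {q q' A S : ℕ} (h1 : q + A ≤ q' + S) (h2 : q' + S ≤ q + A ∨ q' ≤ A) :
    (q' : ℝ) ^ 2 ≤ q ^ 2 + 2 * q * ((A : ℝ) - S) + (2 * A ^ 2 + S ^ 2) := by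
  have h1' : (q : ℝ) + A ≤ q' + S := by exact_mod_cast h1
  have h0 : (0 : ℝ) ≤ q' := q'.cast_nonneg
  have hA : (0 : ℝ) ≤ A := A.cast_nonneg
  have hS : (0 : ℝ) ≤ S := S.cast_nonneg
  rcases h2 with h2 | h2
  · have h2' : (q' : ℝ) + S ≤ q + A := by exact_mod_cast h2
    have : (q' : ℝ) = q + A - S := by linarith
    rw [this]
    nlinarith [mul_nonneg hA hS]
  · have h2' : (q' : ℝ) ≤ A := by exact_mod_cast h2
    nlinarith [sq_nonneg ((q : ℝ) + A - S), mul_nonneg hA hS]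

/-- The change lies in `[-S, A]`. The looser right side matches `sq_le_of_bounds`, so that one
constant controls both the second-order term and the squared jump. -/
theorem sub_sq_le_of_bounds {q q' A S : ℕ} (h1 : q + A ≤ q' + S)
    (h2 : q' + S ≤ q + A ∨ q' ≤ A) :
    ((q' : ℝ) - q) ^ 2 ≤ 2 * A ^ 2 + S ^ 2 := by
  have h1' : (q : ℝ) - q' ≤ S := by
    have : q ≤ q' + S := by omega
    have : (q : ℝ) ≤ q' + S := by exact_mod_cast this
    linarith
  have h2' : (q' : ℝ) - q ≤ A := by
    have : q' ≤ q + A := by omega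
    have : (q' : ℝ) ≤ q + A := by exact_mod_cast this
    linarith
  have hA : (0 : ℝ) ≤ A := A.cast_nonneg
  have hS : (0 : ℝ) ≤ S := S.cast_nonneg
  rcases le_total (q : ℝ) q' with h | h
  · nlinarith
  · nlinarith

/-- A bound, for the total over the servers, of the scaled second-order terms of a cycle. -/
noncomputable def noiseBound (n T : ℕ) (γ : Fin n → ℝ) (Amax Smax : ℝ) : ℝ :=
  T ^ 2 * (∑ l, (γ l)⁻¹) * (2 * (n * Amax) ^ 2 + n * Smax ^ 2)

theorem sum_second_order_le (γ : Fin n → ℝ) (hγ : ∀ l, 0 < γ l) {Amax Smax : ℝ}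
    (j : Fin T → Fin n) (a : Fin T → ℕ) (s : Fin T → Fin n → ℕ)
    (ha : ∀ t, (a t : ℝ) ≤ n * Amax) (hs : ∀ t l, (s t l : ℝ) ≤ Smax) :
    ∑ l, (2 * (cycleArrivals j a l : ℝ) ^ 2 + (cycleServices s l : ℝ) ^ 2) / γ l
      ≤ noiseBound n T γ Amax Smax := by
  -- Each slot's arrivals join a single queue, so the total over queues carries no extra factor `n`.
  have hA : (∑ l, (cycleArrivals j a l : ℝ)) ≤ T * (n * Amax) := by
    rw [← Nat.cast_sum, sum_cycleArrivals, Nat.cast_sum]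
    simpa using Finset.sum_le_sum fun t (_ : t ∈ Finset.univ) => ha t
  have hA2 : ∑ l, (cycleArrivals j a l : ℝ) ^ 2 ≤ (T * (n * Amax)) ^ 2 := by
    refine (Finset.sum_sq_le_sq_sum_of_nonneg fun l _ => Nat.cast_nonneg _).trans ?_
    have : 0 ≤ ∑ l, (cycleArrivals j a l : ℝ) := Finset.sum_nonneg fun l _ => Nat.cast_nonneg _
    gcongr
  have hS2 : ∑ l, (cycleServices s l : ℝ) ^ 2 ≤ n * (T * Smax) ^ 2 := by
    have h (l : Fin n) : (cycleServices s l : ℝ) ^ 2 ≤ (T * Smax) ^ 2 := by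
      have : (cycleServices s l : ℝ) ≤ T * Smax := by
        simp only [cycleServices, Nat.cast_sum]
        simpa using Finset.sum_le_sum fun t (_ : t ∈ Finset.univ) => hs t l
      gcongr
    simpa using Finset.sum_le_sum fun l (_ : l ∈ Finset.univ) => h l
  -- Replacing each `1 / γ_l` by the sum of all of them costs a factor of order `n` when `γ` is
  -- bounded above and below.
  have hg (l : Fin n) : (γ l)⁻¹ ≤ ∑ i, (γ i)⁻¹ :=
    Finset.single_le_sum (f := fun i => (γ i)⁻¹) (fun i _ => (inv_pos.2 (hγ i)).le)
      (Finset.mem_univ l)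
  have hg0 : 0 ≤ ∑ i, (γ i)⁻¹ := Finset.sum_nonneg fun i _ => (inv_pos.2 (hγ i)).le
  calc _ ≤ ∑ l, (2 * (cycleArrivals j a l : ℝ) ^ 2 + (cycleServices s l : ℝ) ^ 2)
          * ∑ i, (γ i)⁻¹ := by
        refine Finset.sum_le_sum fun l _ => ?_
        rw [div_eq_mul_inv]
        exact mul_le_mul_of_nonneg_left (hg l) (by positivity)
    _ = (2 * ∑ l, (cycleArrivals j a l : ℝ) ^ 2 + ∑ l, (cycleServices s l : ℝ) ^ 2)
          * ∑ i, (γ i)⁻¹ := by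
        rw [← Finset.sum_mul, Finset.sum_add_distrib, ← Finset.mul_sum]
    _ ≤ (2 * (T * (n * Amax)) ^ 2 + n * (T * Smax) ^ 2) * ∑ i, (γ i)⁻¹ := by gcongr
    _ = _ := by rw [noiseBound]; ring

end Slots

/-! ### The slack in the majorization condition. -/

section Gap

variable {n T : ℕ}

/-- The smallest slack in the majorization condition, capped at `1 / n`. -/
noncomputable def majorizationGap (f : Equiv.Perm (Fin n) → Fin n → ℝ) (μ : Fin n → ℝ) : ℝ :=
  (Finset.univ ×ˢ Finset.Ico 1 n).fold min (1 / (n : ℝ)) fun p : Equiv.Perm (Fin n) × ℕ =>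
    partialSum (fun l => μ (p.1 l)) p.2 / ∑ l, μ (p.1 l) - partialSum (f p.1) p.2

/-- The cap supplies a positive value when `n = 1`, where no constraint exists, and the upper bound
on the rate used for the lower estimate of `collapseBound`. -/
theorem majorizationGap_le_one_div (f : Equiv.Perm (Fin n) → Fin n → ℝ) (μ : Fin n → ℝ) :
    majorizationGap f μ ≤ 1 / n :=
  (Finset.fold_min_le _).2 (Or.inl le_rfl)

theorem majorizationGap_le (f : Equiv.Perm (Fin n) → Fin n → ℝ) (μ : Fin n → ℝ)
    (η : Equiv.Perm (Fin n)) (m : ℕ) (h1 : 1 ≤ m) (h2 : m < n) :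
    majorizationGap f μ
      ≤ partialSum (fun l => μ (η l)) m / ∑ l, μ (η l) - partialSum (f η) m :=
  (Finset.fold_min_le _).2 (Or.inr ⟨(η, m), by simp [h1, h2], le_rfl⟩)

theorem Policy.StrictMajorization.majorizationGap_pos {P : Policy n T} {μ : Fin n → ℝ}
    (hn : 1 ≤ n) (h : P.StrictMajorization μ) : 0 < majorizationGap (P.f μ) μ := by
  refine (Finset.lt_fold_min _).2 ⟨by positivity, fun p hp => ?_⟩
  simp only [Finset.mem_product, Finset.mem_univ, true_and, Finset.mem_Ico] at hp
  exact sub_pos.2 (h p.1 p.2 hp.1 hp.2)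

theorem Policy.MajorizationSlack.le_majorizationGap {P : Policy n T} {μ : Fin n → ℝ} {θ : ℝ}
    (h : P.MajorizationSlack μ (θ / n)) : min θ 1 / n ≤ majorizationGap (P.f μ) μ := by
  refine (Finset.le_fold_min _).2 ⟨by gcongr; exact min_le_right _ _, fun p hp => ?_⟩
  simp only [Finset.mem_product, Finset.mem_univ, true_and, Finset.mem_Ico] at hp
  have h1 := h p.1 p.2 hp.1 hp.2
  have h2 : min θ 1 / n ≤ θ / n := by gcongr; exact min_le_left _ _
  linarith

end Gap

/-! ### Mean drift given the permutation. -/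

section MeanFraction

variable {n T : ℕ}

theorem Policy.measurable_dispatch (P : Policy n T) {μ : Fin n → ℝ} (hμ : ∀ l, 0 < μ l)
    (η : Equiv.Perm (Fin n)) (t : Fin T) : Measurable fun w => P.dispatch η μ w t :=
  (measurable_pi_iff.1 (P.dispatch_measurable η μ hμ)) t

theorem Policy.integrable_comp_dispatch (P : Policy n T) {μ : Fin n → ℝ} (hμ : ∀ l, 0 < μ l)
    (η : Equiv.Perm (Fin n)) (t : Fin T) (y : Fin n → ℝ) :
    Integrable (fun w => y (P.dispatch η μ w t)) (volume : Measure unitInterval) := by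
  refine Integrable.of_bound ((Measurable.of_discrete (f := y)).comp
    (P.measurable_dispatch hμ η t)).aestronglyMeasurable (∑ l, |y l|) (.of_forall fun w => ?_)
  exact Finset.single_le_sum (f := fun l => |y l|) (fun _ _ => abs_nonneg _) (Finset.mem_univ _)

/-- A function of the chosen server is a linear combination of position indicators, so its mean
depends on the policy only through `f`. -/
theorem Policy.sum_integral_comp_dispatch (P : Policy n T) (hT : 1 ≤ T) {μ : Fin n → ℝ}
    (hμ : ∀ l, 0 < μ l) (η : Equiv.Perm (Fin n)) (y : Fin n → ℝ) :
    ∑ t, ∫ w, y (P.dispatch η μ w t) = T * ∑ i, y (η i) * P.f μ η i := by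
  have hT' : (T : ℝ) ≠ 0 := by positivity
  have hint (i : Fin n) (t : Fin T) : Integrable (fun w =>
      if P.dispatch η μ w t = η i then (1 : ℝ) else 0) (volume : Measure unitInterval) :=
    P.integrable_comp_dispatch hμ η t fun l => if l = η i then 1 else 0
  have hf (i : Fin n) : T * P.f μ η i
      = ∑ t, ∫ w, if P.dispatch η μ w t = η i then (1 : ℝ) else 0 := by
    simp only [Policy.f, Policy.frac]
    rw [integral_div, integral_finsetSum _ fun t _ => hint i t]
    field_simp
  have hy (l : Fin n) : y l = ∑ i, y (η i) * if l = η i then (1 : ℝ) else 0 := by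
    rw [Equiv.sum_comp η fun k => y k * if l = k then (1 : ℝ) else 0]
    simp
  calc _ = ∑ t, ∑ i, y (η i) * ∫ w, if P.dispatch η μ w t = η i then (1 : ℝ) else 0 := by
        refine Finset.sum_congr rfl fun t _ => ?_
        simp_rw [← integral_const_mul]
        rw [← integral_finsetSum _ fun i _ => (hint i t).const_mul _]
        congr with w
        exact hy _
    _ = _ := by
        rw [Finset.sum_comm, Finset.mul_sum]
        refine Finset.sum_congr rfl fun i _ => ?_
        rw [mul_left_comm, hf, Finset.mul_sum]

theorem Policy.f_nonneg (P : Policy n T) (μ : Fin n → ℝ) (η : Equiv.Perm (Fin n)) (i : Fin n) :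
    0 ≤ P.f μ η i := by
  refine integral_nonneg fun w => ?_
  simp only [Policy.frac]
  exact div_nonneg (Finset.sum_nonneg fun t _ => by split_ifs <;> simp) (Nat.cast_nonneg _)

theorem Policy.sum_f (P : Policy n T) (hT : 1 ≤ T) {μ : Fin n → ℝ}
    (hμ : ∀ l, 0 < μ l) (η : Equiv.Perm (Fin n)) : ∑ i, P.f μ η i = 1 := by
  have hT' : (T : ℝ) ≠ 0 := by positivity
  have h := P.sum_integral_comp_dispatch hT hμ η fun _ => 1
  simp only [one_mul, integral_const, probReal_univ, smul_eq_mul, mul_one, Finset.sum_const,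
    Finset.card_univ, Fintype.card_fin, nsmul_eq_mul] at h
  exact mul_left_cancel₀ hT' (by linarith)

theorem partialSum_sub_div (f g : Fin n → ℝ) (c : ℝ) (m : ℕ) :
    partialSum (fun i => f i - g i / c) m = partialSum f m - partialSum g m / c := by
  simp only [partialSum, Finset.sum_sub_distrib, Finset.sum_div]

/-- The mean drift, over a cycle with permutation `η`, of a linear functional whose weights
decrease along `η`. -/
theorem Policy.sum_mul_f_sub_le (P : Policy n T) (hn : 1 ≤ n) (hT : 1 ≤ T) {μ : Fin n → ℝ}
    (hμ : ∀ l, 0 < μ l) (η : Equiv.Perm (Fin n)) (y : Fin n → ℝ) (hy : Antitone fun i => y (η i))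
    {hi lo : ℝ} (hhi : ∃ l, hi ≤ y l) (hlo : ∃ l, y l ≤ lo) (hlo' : ∀ l, lo ≤ y l)
    (hgap : 0 ≤ majorizationGap (P.f μ) μ) {lam : ℝ} (hlam : n * lam ≤ ∑ l, μ l) :
    n * lam * ∑ i, y (η i) * P.f μ η i - ∑ l, y l * μ l
      ≤ -(majorizationGap (P.f μ) μ * (∑ l, μ l)) * (hi - lo)
        - ((∑ l, μ l) - n * lam) * lo := by
  obtain ⟨k, rfl⟩ : ∃ k, n = k + 1 := ⟨n - 1, by omega⟩
  have hM : 0 < ∑ l, μ l := Finset.sum_pos (fun l _ => hμ l) Finset.univ_nonempty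
  have hMη : ∑ l, μ (η l) = ∑ l, μ l := Equiv.sum_comp η μ
  set δ := majorizationGap (P.f μ) μ with hδ
  have h := sum_mul_le_of_partialSum_le (fun i => y (η i))
    (fun i => P.f μ η i - μ (η i) / ∑ l, μ l) δ hy (fun m h1 h2 => by
      rw [partialSum_sub_div (P.f μ η) (fun i => μ (η i))]
      have := majorizationGap_le (P.f μ) μ η m h1 h2
      rw [hMη] at this
      linarith)
  have h0 : ∑ i, (P.f μ η i - μ (η i) / ∑ l, μ l) = 0 := by
    rw [Finset.sum_sub_distrib, P.sum_f hT hμ, ← Finset.sum_div, hMη, div_self hM.ne', sub_self]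
  rw [h0, mul_zero, add_zero] at h
  have h1 : hi ≤ y (η 0) := by
    obtain ⟨l, hl⟩ := hhi
    refine hl.trans ?_
    simpa using hy (Fin.zero_le (η.symm l))
  have h2 : y (η (Fin.last k)) ≤ lo := by
    obtain ⟨l, hl⟩ := hlo
    refine le_trans ?_ hl
    simpa using hy (Fin.le_last (η.symm l))
  have h3 : ∑ i, y (η i) * (P.f μ η i - μ (η i) / ∑ l, μ l) ≤ -δ * (hi - lo) := by
    refine h.trans ?_
    nlinarith [mul_nonneg hgap (sub_nonneg.2 h1), mul_nonneg hgap (sub_nonneg.2 h2)]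
  have h4 : lo ≤ ∑ i, y (η i) * P.f μ η i := by
    calc lo = ∑ i, lo * P.f μ η i := by rw [← Finset.mul_sum, P.sum_f hT hμ, mul_one]
      _ ≤ _ := Finset.sum_le_sum fun i _ =>
        mul_le_mul_of_nonneg_right (hlo' _) (P.f_nonneg μ η i)
  have h5 : ∑ l, y l * μ l = (∑ l, μ l) * ∑ i, y (η i) * (μ (η i) / ∑ l, μ l) := by
    rw [← Equiv.sum_comp η fun l => y l * μ l, Finset.mul_sum]
    refine Finset.sum_congr rfl fun i _ => ?_
    field_simp
  -- With `M = ∑ μ` and `ε = M - nλ`, the drift is `M ∑ y (f - μ/M) - ε ∑ y f`; `h3` bounds the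
  -- first sum and `h4` the second.
  simp only [mul_sub, Finset.sum_sub_distrib] at h3
  rw [h5]
  nlinarith [mul_le_mul_of_nonneg_left h3 hM.le, mul_le_mul_of_nonneg_left h4 (sub_nonneg.2 hlam)]

end MeanFraction

end LoadBalancing

namespace LoadBalancing

/-! ### Measurability and means under the cycle noise. -/

section Noise

variable {n T : ℕ}

theorem isProbabilityMeasure_cycleNoise {α : Measure ℕ} {σ : Measure (Fin n → ℕ)}
    [IsProbabilityMeasure α] [IsProbabilityMeasure σ] :
    IsProbabilityMeasure (cycleNoise T α σ) := by
  unfold cycleNoise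
  infer_instance

theorem ae_cycleNoise_le {α : Measure ℕ} {σ : Measure (Fin n → ℕ)} {lam Amax Smax : ℝ}
    {μ : Fin n → ℝ} (hα : IsArrivalLaw n lam Amax α) (hσ : IsServiceLaw μ Smax σ) :
    ∀ᵐ ω ∂(cycleNoise T α σ), (∀ t, (ω.2.2.1 t : ℝ) ≤ n * Amax) ∧
      ∀ t l, (ω.2.2.2 t l : ℝ) ≤ Smax := by
  have := hα.isProb
  have := hσ.isProb
  have h3 : Measure.QuasiMeasurePreserving (fun ω : CycleNoise n T => ω.2.2)
      (cycleNoise T α σ) ((Measure.pi fun _ => α).prod (Measure.pi fun _ => σ)) :=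
    Measure.quasiMeasurePreserving_snd.comp Measure.quasiMeasurePreserving_snd
  refine Filter.Eventually.and ?_ ?_
  · refine ae_all_iff.2 fun t => ?_
    exact ((Measure.quasiMeasurePreserving_eval _ t).comp
      (Measure.quasiMeasurePreserving_fst.comp h3)).ae hα.le_max
  · refine ae_all_iff.2 fun t => ?_
    exact ((Measure.quasiMeasurePreserving_eval _ t).comp
      (Measure.quasiMeasurePreserving_snd.comp h3)).ae hσ.le_max

/-- There are finitely many permutations, so each preimage is a finite union of measurable
rectangles. -/
theorem Policy.measurable_dispatch_sort (P : Policy n T) {μ : Fin n → ℝ} (hμ : ∀ l, 0 < μ l)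
    (o : Fin n → ℝ) : Measurable fun z : unitInterval × unitInterval =>
      P.dispatch (P.sort o z.1) μ z.2 := by
  refine measurable_pi_iff.2 fun t => measurable_to_countable' fun l => ?_
  have : (fun z : unitInterval × unitInterval => P.dispatch (P.sort o z.1) μ z.2 t) ⁻¹' {l}
      = ⋃ η, {v | P.sort o v = η} ×ˢ ((fun w => P.dispatch η μ w t) ⁻¹' {l}) := by
    ext z
    simp
  rw [this]
  exact .iUnion fun η => (P.sort_measurable o η).prod
    (P.measurable_dispatch hμ η t (measurableSet_singleton l))

theorem Policy.measurable_comp_noise (P : Policy n T) {μ : Fin n → ℝ} (hμ : ∀ l, 0 < μ l)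
    (o : Fin n → ℝ) {β : Type*} [MeasurableSpace β]
    (g : (Fin T → Fin n) → (Fin T → ℕ) → (Fin T → Fin n → ℕ) → β) :
    Measurable fun ω : CycleNoise n T =>
      g (P.dispatch (P.sort o ω.1) μ ω.2.1) ω.2.2.1 ω.2.2.2 := by
  have h : Measurable fun ω : CycleNoise n T =>
      (P.dispatch (P.sort o ω.1) μ ω.2.1, ω.2.2.1, ω.2.2.2) :=
    ((P.measurable_dispatch_sort hμ o).comp
      (measurable_fst.prodMk (measurable_fst.comp measurable_snd))).prodMk
      (measurable_snd.comp measurable_snd)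
  exact (Measurable.of_discrete
    (f := fun z : (Fin T → Fin n) × (Fin T → ℕ) × (Fin T → Fin n → ℕ) => g z.1 z.2.1 z.2.2)).comp h

theorem Policy.measurable_cycleStep (P : Policy n T) {μ : Fin n → ℝ} (hμ : ∀ l, 0 < μ l)
    (q : Fin n → ℕ) : Measurable (P.cycleStep μ q) :=
  P.measurable_comp_noise hμ (fun l => (q l : ℝ) / P.γ l)
    fun j a s => Fin.foldl T (fun x t => slotStep (j t) (a t) (s t) x) q

theorem Policy.isMarkovKernel_sampledChain (P : Policy n T) {μ : Fin n → ℝ} (hμ : ∀ l, 0 < μ l)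
    {α : Measure ℕ} {σ : Measure (Fin n → ℕ)} [IsProbabilityMeasure α] [IsProbabilityMeasure σ] :
    IsMarkovKernel (P.sampledChain μ α σ) := by
  have : IsProbabilityMeasure (cycleNoise T α σ) := isProbabilityMeasure_cycleNoise
  exact ⟨fun q => Measure.isProbabilityMeasure_map (P.measurable_cycleStep hμ q).aemeasurable⟩

theorem sum_mul_netInput (y : Fin n → ℝ) (j : Fin T → Fin n) (a : Fin T → ℕ)
    (s : Fin T → Fin n → ℕ) :
    ∑ l, y l * netInput j a s l
      = ∑ t, y (j t) * (a t : ℝ) - ∑ t, ∑ l, y l * (s t l : ℝ) := by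
  simp only [netInput, cycleArrivals, cycleServices, mul_sub, Finset.sum_sub_distrib,
    Nat.cast_sum, Finset.mul_sum]
  congr 1
  · rw [Finset.sum_comm]
    refine Finset.sum_congr rfl fun t _ => ?_
    simp
  · rw [Finset.sum_comm]

theorem abs_sum_mul_netInput_le (y : Fin n → ℝ) (j : Fin T → Fin n) (a : Fin T → ℕ)
    (s : Fin T → Fin n → ℕ) {A S : ℝ} (ha : ∀ t, (a t : ℝ) ≤ A) (hs : ∀ t l, (s t l : ℝ) ≤ S) :
    |∑ l, y l * netInput j a s l| ≤ ∑ _t : Fin T, ∑ l, |y l| * (A + S) := by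
  rw [sum_mul_netInput, ← Finset.sum_sub_distrib]
  refine (Finset.abs_sum_le_sum_abs _ _).trans (Finset.sum_le_sum fun t _ => ?_)
  have h1 : |y (j t) * (a t : ℝ)| ≤ ∑ l, |y l| * A := by
    rw [abs_mul, Nat.abs_cast, ← Finset.sum_mul]
    have := Finset.single_le_sum (f := fun l => |y l|) (fun _ _ => abs_nonneg _)
      (Finset.mem_univ (j t))
    exact mul_le_mul this (ha t) (Nat.cast_nonneg _) (Finset.sum_nonneg fun _ _ => abs_nonneg _)
  have h2 : |∑ l, y l * (s t l : ℝ)| ≤ ∑ l, |y l| * S := by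
    refine (Finset.abs_sum_le_sum_abs _ _).trans (Finset.sum_le_sum fun l _ => ?_)
    rw [abs_mul, Nat.abs_cast]
    exact mul_le_mul_of_nonneg_left (hs t l) (abs_nonneg _)
  refine (abs_sub _ _).trans ?_
  simp only [mul_add, Finset.sum_add_distrib]
  exact add_le_add h1 h2

theorem Policy.integrable_sum_mul_netInput (P : Policy n T) {μ : Fin n → ℝ} (hμ : ∀ l, 0 < μ l)
    {α : Measure ℕ} {σ : Measure (Fin n → ℕ)} {lam Amax Smax : ℝ}
    (hα : IsArrivalLaw n lam Amax α) (hσ : IsServiceLaw μ Smax σ) (o y : Fin n → ℝ) :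
    Integrable (fun ω : CycleNoise n T =>
      ∑ l, y l * netInput (P.dispatch (P.sort o ω.1) μ ω.2.1) ω.2.2.1 ω.2.2.2 l)
      (cycleNoise T α σ) := by
  have := hα.isProb
  have := hσ.isProb
  have : IsProbabilityMeasure (cycleNoise T α σ) := isProbabilityMeasure_cycleNoise
  refine Integrable.of_bound (P.measurable_comp_noise hμ o fun j a s =>
    ∑ l, y l * netInput j a s l).aestronglyMeasurable
    (∑ _t : Fin T, ∑ l, |y l| * (n * Amax + Smax)) ?_
  filter_upwards [ae_cycleNoise_le hα hσ] with ω hω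
  exact abs_sum_mul_netInput_le y _ _ _ hω.1 hω.2

theorem IsArrivalLaw.integrable {α : Measure ℕ} {lam Amax : ℝ} (hα : IsArrivalLaw n lam Amax α) :
    Integrable (fun a : ℕ => (a : ℝ)) α := by
  have := hα.isProb
  refine Integrable.of_bound (Measurable.of_discrete).aestronglyMeasurable (n * Amax) ?_
  filter_upwards [hα.le_max] with a ha
  simpa using ha

theorem IsServiceLaw.integrable {σ : Measure (Fin n → ℕ)} {μ : Fin n → ℝ} {Smax : ℝ}
    (hσ : IsServiceLaw μ Smax σ) (l : Fin n) : Integrable (fun s : Fin n → ℕ => (s l : ℝ)) σ := by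
  have := hσ.isProb
  refine Integrable.of_bound (Measurable.of_discrete).aestronglyMeasurable Smax ?_
  filter_upwards [hσ.le_max] with s hs
  simpa using hs l

/-- The mean of a linear functional of the net input of a cycle, given the permutation. -/
theorem Policy.integral_sum_mul_netInput_fiber (P : Policy n T) (hT : 1 ≤ T) {μ : Fin n → ℝ}
    (hμ : ∀ l, 0 < μ l) {α : Measure ℕ} {σ : Measure (Fin n → ℕ)} {lam Amax Smax : ℝ}
    (hα : IsArrivalLaw n lam Amax α) (hσ : IsServiceLaw μ Smax σ) (η : Equiv.Perm (Fin n))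
    (y : Fin n → ℝ) :
    ∫ z, ∑ l, y l * netInput (P.dispatch η μ z.1) z.2.1 z.2.2 l
        ∂((volume : Measure unitInterval).prod
          ((Measure.pi fun _ : Fin T => α).prod (Measure.pi fun _ : Fin T => σ)))
      = T * (n * lam * ∑ i, y (η i) * P.f μ η i - ∑ l, y l * μ l) := by
  have := hα.isProb
  have := hσ.isProb
  set ν := (Measure.pi fun _ : Fin T => α).prod (Measure.pi fun _ : Fin T => σ) with hν
  have ia (t : Fin T) : Integrable (fun z : (Fin T → ℕ) × (Fin T → Fin n → ℕ) => (z.1 t : ℝ)) ν :=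
    (integrable_comp_eval (μ := fun _ : Fin T => α) (i := t) hα.integrable).comp_fst _
  have is (t : Fin T) (l : Fin n) :
      Integrable (fun z : (Fin T → ℕ) × (Fin T → Fin n → ℕ) => (z.2 t l : ℝ)) ν :=
    (integrable_comp_eval (μ := fun _ : Fin T => σ) (i := t) (hσ.integrable l)).comp_snd _
  have ea (t : Fin T) : ∫ z, (z.1 t : ℝ) ∂ν = n * lam := by
    rw [hν, integral_fun_fst (fun a : Fin T → ℕ => (a t : ℝ)),
      integral_comp_eval (μ := fun _ : Fin T => α) (i := t) (f := fun a : ℕ => (a : ℝ))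
        hα.integrable.aestronglyMeasurable, hα.mean]
    simp
  have es (t : Fin T) (l : Fin n) : ∫ z, (z.2 t l : ℝ) ∂ν = μ l := by
    rw [hν, integral_fun_snd (fun s : Fin T → Fin n → ℕ => (s t l : ℝ)),
      integral_comp_eval (μ := fun _ : Fin T => σ) (i := t) (f := fun s : Fin n → ℕ => (s l : ℝ))
        (hσ.integrable l).aestronglyMeasurable, hσ.mean]
    simp
  have i1 (t : Fin T) : Integrable
      (fun z : unitInterval × (Fin T → ℕ) × (Fin T → Fin n → ℕ) =>
        y (P.dispatch η μ z.1 t) * (z.2.1 t : ℝ)) (volume.prod ν) :=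
    (P.integrable_comp_dispatch hμ η t y).mul_prod (ia t)
  have i2 (t : Fin T) (l : Fin n) : Integrable
      (fun z : unitInterval × (Fin T → ℕ) × (Fin T → Fin n → ℕ) => y l * (z.2.2 t l : ℝ))
      (volume.prod ν) :=
    ((is t l).comp_snd _).const_mul _
  have e1 (t : Fin T) : ∫ z : unitInterval × (Fin T → ℕ) × (Fin T → Fin n → ℕ),
      y (P.dispatch η μ z.1 t) * (z.2.1 t : ℝ) ∂(volume.prod ν)
      = (∫ w, y (P.dispatch η μ w t)) * (n * lam) := by
    rw [integral_prod_mul (fun w => y (P.dispatch η μ w t))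
      (fun z : (Fin T → ℕ) × (Fin T → Fin n → ℕ) => (z.1 t : ℝ)), ea]
  have e2 (t : Fin T) (l : Fin n) : ∫ z : unitInterval × (Fin T → ℕ) × (Fin T → Fin n → ℕ),
      y l * (z.2.2 t l : ℝ) ∂(volume.prod ν) = y l * μ l := by
    rw [integral_const_mul,
      integral_fun_snd (fun z : (Fin T → ℕ) × (Fin T → Fin n → ℕ) => (z.2 t l : ℝ)), es]
    simp
  simp_rw [sum_mul_netInput]
  rw [integral_sub (integrable_finsetSum _ fun t _ => i1 t)
    (integrable_finsetSum _ fun t _ => integrable_finsetSum _ fun l _ => i2 t l),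
    integral_finsetSum _ fun t _ => i1 t,
    integral_finsetSum _ fun t _ => integrable_finsetSum _ fun l _ => i2 t l]
  simp_rw [e1, ← Finset.sum_mul, P.sum_integral_comp_dispatch hT hμ η y,
    integral_finsetSum _ fun l (_ : l ∈ Finset.univ) => i2 _ l, e2]
  simp only [Finset.sum_const, Finset.card_univ, Fintype.card_fin, nsmul_eq_mul]
  ring

/-- The mean drift over a cycle of a linear functional whose weights decrease along every
permutation that the sorting function may choose. -/
theorem Policy.integral_sum_mul_netInput_le (P : Policy n T) (hn : 1 ≤ n) (hT : 1 ≤ T)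
    {μ : Fin n → ℝ} (hμ : ∀ l, 0 < μ l) {α : Measure ℕ} {σ : Measure (Fin n → ℕ)}
    {lam Amax Smax : ℝ} (hα : IsArrivalLaw n lam Amax α) (hσ : IsServiceLaw μ Smax σ)
    (hgap : 0 ≤ majorizationGap (P.f μ) μ) (hlam : n * lam ≤ ∑ l, μ l) (o y : Fin n → ℝ)
    (hy : ∀ v, Antitone fun i => y (P.sort o v i))
    {hi lo : ℝ} (hhi : ∃ l, hi ≤ y l) (hlo : ∃ l, y l ≤ lo) (hlo' : ∀ l, lo ≤ y l) :
    ∫ ω, ∑ l, y l * netInput (P.dispatch (P.sort o ω.1) μ ω.2.1) ω.2.2.1 ω.2.2.2 l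
        ∂(cycleNoise T α σ)
      ≤ T * (-(majorizationGap (P.f μ) μ * (∑ l, μ l)) * (hi - lo)
        - ((∑ l, μ l) - n * lam) * lo) := by
  have := hα.isProb
  have := hσ.isProb
  have hint := P.integrable_sum_mul_netInput hμ hα hσ o y
  rw [cycleNoise] at hint ⊢
  -- Fixing the sorting variable fixes the permutation, and the bound is the same for all of them.
  rw [integral_prod _ hint]
  refine (integral_mono hint.integral_prod_left (integrable_const _) fun v => ?_).trans_eq
    (?_ : ∫ _v : unitInterval, T * (-(majorizationGap (P.f μ) μ * (∑ l, μ l)) * (hi - lo)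
        - ((∑ l, μ l) - n * lam) * lo) = _)
  · simp only
    rw [P.integral_sum_mul_netInput_fiber hT hμ hα hσ (P.sort o v) y]
    exact mul_le_mul_of_nonneg_left (P.sum_mul_f_sub_le hn hT hμ _ y (hy v) hhi hlo hlo' hgap hlam)
      (Nat.cast_nonneg _)
  · simp

/-- A pathwise second-order expansion of a Lyapunov function over a cycle, with a linear term
along the net input, gives the drift of the Lyapunov function in mean. -/
theorem Policy.lintegral_sampledChain_add_le (P : Policy n T) {μ : Fin n → ℝ} (hμ : ∀ l, 0 < μ l)
    {α : Measure ℕ} {σ : Measure (Fin n → ℕ)} {lam Amax Smax : ℝ}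
    (hα : IsArrivalLaw n lam Amax α) (hσ : IsServiceLaw μ Smax σ) (q : Fin n → ℕ)
    (V : (Fin n → ℕ) → ℝ) (hV : ∀ x, 0 ≤ V x) (y : Fin n → ℝ) (r f b : ℝ) (hf : 0 ≤ f)
    (hpath : ∀ᵐ ω ∂(cycleNoise T α σ), V (P.cycleStep μ q ω) ≤ r +
      ∑ l, y l * netInput (P.dispatch (P.sort (fun l => (q l : ℝ) / P.γ l) ω.1) μ ω.2.1)
        ω.2.2.1 ω.2.2.2 l)
    (hmean : r + ∫ ω, ∑ l, y l *
        netInput (P.dispatch (P.sort (fun l => (q l : ℝ) / P.γ l) ω.1) μ ω.2.1)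
          ω.2.2.1 ω.2.2.2 l ∂(cycleNoise T α σ) + f ≤ V q + b) (hb : 0 ≤ b) :
    ∫⁻ x, ENNReal.ofReal (V x) ∂(P.sampledChain μ α σ q) + ENNReal.ofReal f
      ≤ ENNReal.ofReal (V q) + ENNReal.ofReal b := by
  have := hα.isProb
  have := hσ.isProb
  have : IsProbabilityMeasure (cycleNoise T α σ) := isProbabilityMeasure_cycleNoise
  have hint := P.integrable_sum_mul_netInput hμ hα hσ (fun l => (q l : ℝ) / P.γ l) y
  have hmap : P.sampledChain μ α σ q = (cycleNoise T α σ).map (P.cycleStep μ q) := rfl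
  -- The majorant inherits nonnegativity from `V`, so its `lintegral` is its Bochner integral.
  have hpos : ∀ᵐ ω ∂(cycleNoise T α σ), 0 ≤ r +
      ∑ l, y l * netInput (P.dispatch (P.sort (fun l => (q l : ℝ) / P.γ l) ω.1) μ ω.2.1)
        ω.2.2.1 ω.2.2.2 l := by
    filter_upwards [hpath] with ω hω using (hV _).trans hω
  rw [hmap, lintegral_map (Measurable.of_discrete) (P.measurable_cycleStep hμ q)]
  calc _ ≤ ∫⁻ ω, ENNReal.ofReal (r +
          ∑ l, y l * netInput (P.dispatch (P.sort (fun l => (q l : ℝ) / P.γ l) ω.1) μ ω.2.1)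
            ω.2.2.1 ω.2.2.2 l) ∂(cycleNoise T α σ) + ENNReal.ofReal f := by
        gcongr 1
        refine lintegral_mono_ae ?_
        filter_upwards [hpath] with ω hω using ENNReal.ofReal_le_ofReal hω
    _ = ENNReal.ofReal (∫ ω, (r +
          ∑ l, y l * netInput (P.dispatch (P.sort (fun l => (q l : ℝ) / P.γ l) ω.1) μ ω.2.1)
            ω.2.2.1 ω.2.2.2 l) ∂(cycleNoise T α σ)) + ENNReal.ofReal f := by
        congr 1
        exact (ofReal_integral_eq_lintegral_ofReal ((integrable_const r).add hint) hpos).symm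
    _ ≤ ENNReal.ofReal (V q) + ENNReal.ofReal b := by
        rw [← ENNReal.ofReal_add (integral_nonneg_of_ae hpos) hf, ← ENNReal.ofReal_add (hV q) hb]
        refine ENNReal.ofReal_le_ofReal ?_
        rw [integral_add (integrable_const r) hint]
        simpa using hmean

end Noise

end LoadBalancing

/-! ### Geometry of the perpendicular component. -/

theorem norm_sub_proj_sq {E : Type*} [NormedAddCommGroup E] [InnerProductSpace ℝ E] (c v : E) :
    ‖v - (inner ℝ c v / inner ℝ c c) • c‖ ^ 2 = ‖v‖ ^ 2 - inner ℝ c v ^ 2 / inner ℝ c c := by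
  by_cases hc : c = 0
  · simp [hc]
  have h : inner ℝ c c ≠ 0 := inner_self_ne_zero.2 hc
  rw [norm_sub_sq_real, norm_smul, inner_smul_right, real_inner_comm, mul_pow,
    ← real_inner_self_eq_norm_sq c, Real.norm_eq_abs, sq_abs]
  field_simp
  ring

namespace LoadBalancing

section Geometry

variable {n T : ℕ}

theorem norm_scaledQueue_sub_sq (γ : Fin n → ℝ) (hγ : ∀ l, 0 < γ l) (q q' : Fin n → ℕ) :
    ‖scaledQueue γ q' - scaledQueue γ q‖ ^ 2 = ∑ l, ((q' l : ℝ) - q l) ^ 2 / γ l := by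
  rw [EuclideanSpace.norm_sq_eq]
  refine Finset.sum_congr rfl fun l _ => ?_
  simp only [scaledQueue, PiLp.sub_apply, Real.norm_eq_abs, sq_abs]
  rw [← sub_div, div_pow, Real.sq_sqrt (hγ l).le]

theorem norm_scaledQueue_sq (γ : Fin n → ℝ) (hγ : ∀ l, 0 < γ l) (q : Fin n → ℕ) :
    ‖scaledQueue γ q‖ ^ 2 = ∑ l, (q l : ℝ) ^ 2 / γ l := by
  rw [EuclideanSpace.norm_sq_eq]
  refine Finset.sum_congr rfl fun l _ => ?_
  simp only [scaledQueue, Real.norm_eq_abs, sq_abs]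
  rw [div_pow, Real.sq_sqrt (hγ l).le]

theorem inner_collapseDir_scaledQueue (γ : Fin n → ℝ) (hγ : ∀ l, 0 < γ l) (q : Fin n → ℕ) :
    inner ℝ (collapseDir γ) (scaledQueue γ q) = ∑ l, (q l : ℝ) := by
  simp only [PiLp.inner_apply, collapseDir, scaledQueue, RCLike.inner_apply, conj_trivial]
  refine Finset.sum_congr rfl fun l _ => ?_
  have := (Real.sqrt_pos.2 (hγ l)).ne'
  field_simp

theorem inner_collapseDir_self (γ : Fin n → ℝ) (hγ : ∀ l, 0 < γ l) :
    inner ℝ (collapseDir γ) (collapseDir γ) = ∑ l, γ l := by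
  simp only [PiLp.inner_apply, collapseDir, RCLike.inner_apply, conj_trivial]
  exact Finset.sum_congr rfl fun l _ => Real.mul_self_sqrt (hγ l).le

theorem norm_perpPart_sq (γ : Fin n → ℝ) (hγ : ∀ l, 0 < γ l) (q : Fin n → ℕ) :
    ‖perpPart γ q‖ ^ 2 = ∑ l, (q l : ℝ) ^ 2 / γ l - (∑ l, (q l : ℝ)) ^ 2 / ∑ l, γ l := by
  rw [perpPart, parallelPart, norm_sub_proj_sq, norm_scaledQueue_sq γ hγ,
    inner_collapseDir_scaledQueue γ hγ, inner_collapseDir_self γ hγ]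

/-- The perpendicular part is an orthogonal projection of the scaled queues: linear and
norm-nonincreasing. -/
theorem norm_perpPart_sub_sq_le (γ : Fin n → ℝ) (hγ : ∀ l, 0 < γ l) (q q' : Fin n → ℕ) :
    ‖perpPart γ q' - perpPart γ q‖ ^ 2 ≤ ∑ l, ((q' l : ℝ) - q l) ^ 2 / γ l := by
  have h : perpPart γ q' - perpPart γ q = (scaledQueue γ q' - scaledQueue γ q)
      - (inner ℝ (collapseDir γ) (scaledQueue γ q' - scaledQueue γ q)
        / inner ℝ (collapseDir γ) (collapseDir γ)) • collapseDir γ := by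
    simp only [perpPart, parallelPart, inner_sub_right, sub_div, sub_smul]
    abel
  rw [h, norm_sub_proj_sq, norm_scaledQueue_sub_sq γ hγ]
  exact sub_le_self _ (div_nonneg (sq_nonneg _) real_inner_self_nonneg)

/-- The mean of the scaled queue lengths with weights `γ`. -/
noncomputable def meanScaledQueue (γ : Fin n → ℝ) (q : Fin n → ℕ) : ℝ :=
  (∑ l, (q l : ℝ)) / ∑ l, γ l

theorem meanScaledQueue_mem_Icc (hn : 1 ≤ n) (γ : Fin n → ℝ) (hγ : ∀ l, 0 < γ l) (q : Fin n → ℕ)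
    {lo hi : ℝ} (h : ∀ l, (q l : ℝ) / γ l ∈ Set.Icc lo hi) :
    meanScaledQueue γ q ∈ Set.Icc lo hi := by
  have : NeZero n := ⟨by omega⟩
  have hG : 0 < ∑ l, γ l := Finset.sum_pos (fun l _ => hγ l) Finset.univ_nonempty
  rw [meanScaledQueue, Set.mem_Icc, le_div_iff₀ hG, div_le_iff₀ hG, Finset.mul_sum,
    Finset.mul_sum]
  exact ⟨Finset.sum_le_sum fun l _ => (le_div_iff₀ (hγ l)).1 (h l).1,
    Finset.sum_le_sum fun l _ => (div_le_iff₀ (hγ l)).1 (h l).2⟩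

/-- The perpendicular part is controlled by the spread of the scaled queue lengths. -/
theorem norm_perpPart_le (hn : 1 ≤ n) (γ : Fin n → ℝ) (hγ : ∀ l, 0 < γ l) (q : Fin n → ℕ)
    {lo hi : ℝ} (h : ∀ l, (q l : ℝ) / γ l ∈ Set.Icc lo hi) :
    ‖perpPart γ q‖ ≤ (∑ l, √(γ l)) * (hi - lo) := by
  have : NeZero n := ⟨by omega⟩
  have hm := meanScaledQueue_mem_Icc hn γ hγ q h
  have hd : 0 ≤ hi - lo := sub_nonneg.2 (hm.1.trans hm.2)
  have hcoord (l : Fin n) : |perpPart γ q l| ≤ √(γ l) * (hi - lo) := by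
    have e : perpPart γ q l = √(γ l) * ((q l : ℝ) / γ l - meanScaledQueue γ q) := by
      rw [perpPart, parallelPart, inner_collapseDir_scaledQueue γ hγ,
        inner_collapseDir_self γ hγ]
      simp only [PiLp.sub_apply, PiLp.smul_apply, scaledQueue, collapseDir, smul_eq_mul,
        meanScaledQueue]
      have h1 := Real.mul_self_sqrt (hγ l).le
      have h2 := (Real.sqrt_pos.2 (hγ l)).ne'
      have h3 : (q l : ℝ) / √(γ l) = √(γ l) * (q l / γ l) := by
        rw [div_eq_iff h2, mul_right_comm, h1, mul_div_cancel₀ _ (hγ l).ne']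
      rw [h3]
      ring
    rw [e, abs_mul, abs_of_nonneg (Real.sqrt_nonneg _)]
    refine mul_le_mul_of_nonneg_left ?_ (Real.sqrt_nonneg _)
    rw [abs_le]
    constructor <;> linarith [(h l).1, (h l).2, hm.1, hm.2]
  -- Passing from the `ℓ²` to the `ℓ¹` norm gives the constant `∑ √γ` instead of `√(∑ γ)`.
  rw [EuclideanSpace.norm_eq, Finset.sum_mul]
  refine Real.sqrt_le_iff.2 ⟨Finset.sum_nonneg fun l _ => mul_nonneg (Real.sqrt_nonneg _) hd, ?_⟩
  calc ∑ l, ‖perpPart γ q l‖ ^ 2 ≤ ∑ l, (√(γ l) * (hi - lo)) ^ 2 := by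
        refine Finset.sum_le_sum fun l _ => ?_
        rw [Real.norm_eq_abs]
        have := hcoord l
        gcongr
    _ ≤ _ := Finset.sum_sq_le_sq_sum_of_nonneg fun l _ => mul_nonneg (Real.sqrt_nonneg _) hd

end Geometry

/-! ### Drift inequalities, stability and collapse. -/

section Drift

variable {n T : ℕ}

theorem noiseBound_nonneg {γ : Fin n → ℝ} (hγ : ∀ l, 0 < γ l) (Amax Smax : ℝ) :
    0 ≤ noiseBound n T γ Amax Smax := by
  have : 0 ≤ ∑ l, (γ l)⁻¹ := Finset.sum_nonneg fun i _ => (inv_pos.2 (hγ i)).le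
  unfold noiseBound
  positivity

theorem Policy.sum_sq_cycleStep_le (P : Policy n T) {μ : Fin n → ℝ} {Amax Smax : ℝ}
    (q : Fin n → ℕ) (ω : CycleNoise n T) (hω : (∀ t, (ω.2.2.1 t : ℝ) ≤ n * Amax) ∧
      ∀ t l, (ω.2.2.2 t l : ℝ) ≤ Smax) :
    ∑ l, (P.cycleStep μ q ω l : ℝ) ^ 2 / P.γ l
      ≤ ∑ l, (q l : ℝ) ^ 2 / P.γ l + noiseBound n T P.γ Amax Smax +
        2 * ∑ l, (q l : ℝ) / P.γ l * netInput
          (P.dispatch (P.sort (fun l => (q l : ℝ) / P.γ l) ω.1) μ ω.2.1) ω.2.2.1 ω.2.2.2 l := by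
  set j := P.dispatch (P.sort (fun l => (q l : ℝ) / P.γ l) ω.1) μ ω.2.1 with hj
  have h (l : Fin n) := foldl_slotStep_bounds j ω.2.2.1 ω.2.2.2 q l
  refine le_trans (Finset.sum_le_sum fun l _ => div_le_div_of_nonneg_right
    (sq_le_of_bounds (h l).1 (h l).2) (P.γ_pos l).le) ?_
  have hK := sum_second_order_le P.γ P.γ_pos j ω.2.2.1 ω.2.2.2 hω.1 hω.2
  simp only [add_div, Finset.sum_add_distrib, Finset.mul_sum] at hK ⊢
  have e : ∑ l, 2 * (q l : ℝ) * ((cycleArrivals j ω.2.2.1 l : ℝ) - cycleServices ω.2.2.2 l) / P.γ l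
      = ∑ l, 2 * ((q l : ℝ) / P.γ l * netInput j ω.2.2.1 ω.2.2.2 l) :=
    Finset.sum_congr rfl fun l _ => by rw [netInput]; ring
  rw [e]
  linarith

/-- By Pythagoras the parallel energy `(∑ q)² / ∑ γ` is subtracted, so it must be bounded below. It
is convex in the total queue, and unused service only raises that total, which lies above its
starting value plus the net input. -/
theorem Policy.norm_perpPart_cycleStep_sq_le (P : Policy n T) {μ : Fin n → ℝ}
    {Amax Smax : ℝ} (q : Fin n → ℕ) (ω : CycleNoise n T)
    (hω : (∀ t, (ω.2.2.1 t : ℝ) ≤ n * Amax) ∧ ∀ t l, (ω.2.2.2 t l : ℝ) ≤ Smax) :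
    ‖perpPart P.γ (P.cycleStep μ q ω)‖ ^ 2
      ≤ ‖perpPart P.γ q‖ ^ 2 + noiseBound n T P.γ Amax Smax +
        2 * ∑ l, ((q l : ℝ) / P.γ l - meanScaledQueue P.γ q) * netInput
          (P.dispatch (P.sort (fun l => (q l : ℝ) / P.γ l) ω.1) μ ω.2.1) ω.2.2.1 ω.2.2.2 l := by
  have h1 := P.sum_sq_cycleStep_le (μ := μ) q ω hω
  set j := P.dispatch (P.sort (fun l => (q l : ℝ) / P.γ l) ω.1) μ ω.2.1 with hj
  set q' := P.cycleStep μ q ω with hq'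
  have hb (l : Fin n) : (q l : ℝ) + netInput j ω.2.2.1 ω.2.2.2 l ≤ q' l := by
    have : (q l : ℝ) + cycleArrivals j ω.2.2.1 l ≤ q' l + cycleServices ω.2.2.2 l := by
      exact_mod_cast (foldl_slotStep_bounds j ω.2.2.1 ω.2.2.2 q l).1
    rw [netInput]
    linarith
  have hs : ∑ l, (q l : ℝ) + ∑ l, netInput j ω.2.2.1 ω.2.2.2 l ≤ ∑ l, (q' l : ℝ) := by
    rw [← Finset.sum_add_distrib]
    exact Finset.sum_le_sum fun l _ => hb l
  have hQ : 0 ≤ ∑ l, (q l : ℝ) := Finset.sum_nonneg fun l _ => Nat.cast_nonneg _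
  have hG : 0 ≤ ∑ l, P.γ l := Finset.sum_nonneg fun l _ => (P.γ_pos l).le
  have h2 : (∑ l, (q l : ℝ)) ^ 2 / ∑ l, P.γ l
      + 2 * (meanScaledQueue P.γ q * ∑ l, netInput j ω.2.2.1 ω.2.2.2 l)
      ≤ (∑ l, (q' l : ℝ)) ^ 2 / ∑ l, P.γ l := by
    have e : (∑ l, (q l : ℝ)) ^ 2 / ∑ l, P.γ l
        + 2 * (meanScaledQueue P.γ q * ∑ l, netInput j ω.2.2.1 ω.2.2.2 l)
        = ((∑ l, (q l : ℝ)) ^ 2 + 2 * (∑ l, (q l : ℝ)) * ∑ l, netInput j ω.2.2.1 ω.2.2.2 l)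
          / ∑ l, P.γ l := by
      rw [meanScaledQueue]
      ring
    rw [e]
    refine div_le_div_of_nonneg_right ?_ hG
    nlinarith [sq_nonneg (∑ l, (q' l : ℝ) - ∑ l, (q l : ℝ))]
  rw [norm_perpPart_sq _ P.γ_pos, norm_perpPart_sq _ P.γ_pos]
  simp only [sub_mul, Finset.sum_sub_distrib, ← Finset.mul_sum]
  linarith

theorem Policy.abs_norm_perpPart_cycleStep_sub_le (P : Policy n T) {μ : Fin n → ℝ}
    {Amax Smax : ℝ} (q : Fin n → ℕ) (ω : CycleNoise n T)
    (hω : (∀ t, (ω.2.2.1 t : ℝ) ≤ n * Amax) ∧ ∀ t l, (ω.2.2.2 t l : ℝ) ≤ Smax) :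
    |‖perpPart P.γ (P.cycleStep μ q ω)‖ - ‖perpPart P.γ q‖|
      ≤ √(noiseBound n T P.γ Amax Smax) := by
  set j := P.dispatch (P.sort (fun l => (q l : ℝ) / P.γ l) ω.1) μ ω.2.1 with hj
  refine (abs_norm_sub_norm_le _ _).trans (Real.le_sqrt_of_sq_le ?_)
  refine (norm_perpPart_sub_sq_le P.γ P.γ_pos _ _).trans ?_
  refine le_trans (Finset.sum_le_sum fun l _ => div_le_div_of_nonneg_right ?_ (P.γ_pos l).le)
    (sum_second_order_le P.γ P.γ_pos j ω.2.2.1 ω.2.2.2 hω.1 hω.2)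
  exact sub_sq_le_of_bounds (foldl_slotStep_bounds j ω.2.2.1 ω.2.2.2 q l).1
    (foldl_slotStep_bounds j ω.2.2.1 ω.2.2.2 q l).2

/-- With `Δ = r' - r`, `r'³ - r³ = (3/2) r (r'² - r²) + (3/2) r Δ² + Δ³`. The bound stays linear in
`D`, so means can be taken. -/
theorem cube_le_of_sq_le {r r' b D : ℝ} (hr : 0 ≤ r) (hb : |r' - r| ≤ b)
    (h : r' ^ 2 ≤ r ^ 2 + b ^ 2 + 2 * D) :
    r' ^ 3 ≤ r ^ 3 + 3 * r * b ^ 2 + b ^ 3 + 3 * r * D := by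
  have h2 : (r' - r) ^ 2 ≤ b ^ 2 := sq_le_sq' (abs_le.1 hb).1 (abs_le.1 hb).2
  have h3 : (r' - r) ^ 3 ≤ b ^ 3 :=
    (Odd.strictMono_pow (by decide : Odd 3)).monotone (abs_le.1 hb).2
  nlinarith [mul_le_mul_of_nonneg_left h hr, mul_le_mul_of_nonneg_left h2 hr]

theorem Policy.exists_isSteadyState (P : Policy n T) (hn : 1 ≤ n) (hT : 1 ≤ T) {μ : Fin n → ℝ}
    (hμ : ∀ l, 0 < μ l) {α : Measure ℕ} {σ : Measure (Fin n → ℕ)} {lam Amax Smax : ℝ}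
    (hα : IsArrivalLaw n lam Amax α) (hσ : IsServiceLaw μ Smax σ)
    (hgap : 0 < majorizationGap (P.f μ) μ) (hlam : n * lam < ∑ l, μ l) :
    ∃ π, P.IsSteadyState μ α σ π := by
  have : NeZero n := ⟨by omega⟩
  have := hα.isProb
  have := hσ.isProb
  have := P.isMarkovKernel_sampledChain hμ (α := α) (σ := σ)
  have hM : 0 < ∑ l, μ l := Finset.sum_pos (fun l _ => hμ l) Finset.univ_nonempty
  set δ := majorizationGap (P.f μ) μ with hδ
  set ε := (∑ l, μ l) - n * lam with hε
  have hε0 : 0 < ε := sub_pos.2 hlam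
  -- With `m` below both rates, `δM(hi - lo) + ε lo ≥ m hi`, and `n hi` dominates `∑ x_l`.
  set m := min (δ * ∑ l, μ l) ε with hm
  have hm0 : 0 < m := lt_min (mul_pos hgap hM) hε0
  have hn0 : (0 : ℝ) < n := by exact_mod_cast hn
  have hT0 : (0 : ℝ) < T := by exact_mod_cast hT
  have hx0 (q : Fin n → ℕ) (l : Fin n) : 0 ≤ (q l : ℝ) / P.γ l :=
    div_nonneg (Nat.cast_nonneg _) (P.γ_pos l).le
  refine exists_invariant_of_drift (P.sampledChain μ α σ)
    (fun q => ENNReal.ofReal (∑ l, (q l : ℝ) ^ 2 / P.γ l))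
    (fun q => ENNReal.ofReal (2 * T * m / n * ∑ l, (q l : ℝ) / P.γ l))
    (ENNReal.ofReal (noiseBound n T P.γ Amax Smax)) (fun _ => ENNReal.ofReal_ne_top)
    ENNReal.ofReal_ne_top (fun q => ?_) fun R hR => ?_
  · obtain ⟨l₁, h₁⟩ := Finite.exists_max fun l => (q l : ℝ) / P.γ l
    obtain ⟨l₂, h₂⟩ := Finite.exists_min fun l => (q l : ℝ) / P.γ l
    refine P.lintegral_sampledChain_add_le hμ hα hσ q
      (fun q => ∑ l, (q l : ℝ) ^ 2 / P.γ l)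
      (fun x => Finset.sum_nonneg fun l _ => div_nonneg (sq_nonneg _) (P.γ_pos l).le)
      (fun l => 2 * ((q l : ℝ) / P.γ l))
      (∑ l, (q l : ℝ) ^ 2 / P.γ l + noiseBound n T P.γ Amax Smax) _ _
      (mul_nonneg (by positivity) (Finset.sum_nonneg fun l _ => hx0 q l)) ?_ ?_
      (noiseBound_nonneg P.γ_pos _ _)
    · filter_upwards [ae_cycleNoise_le hα hσ] with ω hω
      simp only [mul_assoc, ← Finset.mul_sum]
      exact P.sum_sq_cycleStep_le q ω hω
    · have h := P.integral_sum_mul_netInput_le hn hT hμ hα hσ hgap.le hlam.le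
        (fun l => (q l : ℝ) / P.γ l) (fun l => 2 * ((q l : ℝ) / P.γ l))
        (fun v => (P.sort_antitone _ v (hx0 q)).const_mul zero_le_two)
        ⟨l₁, le_rfl⟩ ⟨l₂, le_rfl⟩ (fun l => by linarith [h₂ l])
      set hi := (q l₁ : ℝ) / P.γ l₁ with hhi
      set lo := (q l₂ : ℝ) / P.γ l₂ with hlo
      have hsum : ∑ l, (q l : ℝ) / P.γ l ≤ n * hi := by
        simpa using Finset.sum_le_sum fun l (_ : l ∈ Finset.univ) => h₁ l
      have hf : 2 * T * m / n * ∑ l, (q l : ℝ) / P.γ l ≤ 2 * T * m * hi := by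
        refine (mul_le_mul_of_nonneg_left hsum (by positivity)).trans_eq ?_
        field_simp
      have hδm : m * (hi - lo) ≤ (δ * ∑ l, μ l) * (hi - lo) :=
        mul_le_mul_of_nonneg_right (min_le_left _ _) (sub_nonneg.2 (h₂ l₁))
      have hεm : m * lo ≤ ε * lo := mul_le_mul_of_nonneg_right (min_le_right _ _) (hx0 q l₂)
      have hT1 := mul_le_mul_of_nonneg_left (add_le_add hδm hεm) hT0.le
      linarith
  · refine (Set.finite_Iic fun l => ⌈R.toReal / (2 * T * m / n) * P.γ l⌉₊).subset fun q hq => ?_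
    intro l
    have hc : 0 < 2 * T * m / n := by positivity
    have h1 : 2 * T * m / n * ∑ l, (q l : ℝ) / P.γ l ≤ R.toReal :=
      (ENNReal.ofReal_le_iff_le_toReal hR).1 hq
    have h2 : (q l : ℝ) / P.γ l ≤ ∑ l, (q l : ℝ) / P.γ l :=
      Finset.single_le_sum (f := fun l => (q l : ℝ) / P.γ l) (fun i _ => hx0 q i)
        (Finset.mem_univ l)
    have h3 : (q l : ℝ) / P.γ l ≤ R.toReal / (2 * T * m / n) :=
      h2.trans ((le_div_iff₀' hc).2 h1)
    exact_mod_cast ((div_le_iff₀ (P.γ_pos l)).1 h3).trans (Nat.le_ceil _)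

/-- The rate at which a cycle reduces the norm of the perpendicular part, per unit of norm, when
the load deficit is at most half of the majorization gap. -/
noncomputable def collapseRate (n T : ℕ) (γ : Fin n → ℝ) (f : Equiv.Perm (Fin n) → Fin n → ℝ)
    (μ : Fin n → ℝ) : ℝ :=
  T * (majorizationGap f μ * ∑ l, μ l) / (2 * ∑ l, √(γ l))

/-- The bound on the root mean square of the perpendicular part in steady state. -/
noncomputable def collapseBound (n T : ℕ) (γ : Fin n → ℝ)
    (F : Equiv.Perm (Fin n) → (Fin n → ℝ) × (Fin n → ℝ)) (μ : Fin n → ℝ) (Amax Smax : ℝ) : ℝ :=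
  √(noiseBound n T γ Amax Smax) +
    noiseBound n T γ Amax Smax / collapseRate n T γ (fun η => (F η).1) μ

/-- The square has a drift linear in the norm and would bound only a first moment; the cube has a
quadratic drift. -/
theorem Policy.lintegral_norm_perpPart_sq_le (P : Policy n T) (hn : 1 ≤ n) (hT : 1 ≤ T)
    {μ : Fin n → ℝ} (hμ : ∀ l, 0 < μ l) {α : Measure ℕ} {σ : Measure (Fin n → ℕ)}
    {lam Amax Smax : ℝ} (hα : IsArrivalLaw n lam Amax α) (hσ : IsServiceLaw μ Smax σ)
    (hgap : 0 < majorizationGap (P.f μ) μ) (hlam : n * lam ≤ ∑ l, μ l)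
    (hlam' : (∑ l, μ l) - n * lam ≤ majorizationGap (P.f μ) μ * (∑ l, μ l) / 2)
    {π : Measure (Fin n → ℕ)} (hπ : P.IsSteadyState μ α σ π) :
    ∫⁻ q, ENNReal.ofReal (‖perpPart P.γ q‖ ^ 2) ∂π
      ≤ ENNReal.ofReal (collapseBound n T P.γ (P.F μ) μ Amax Smax ^ 2) := by
  have : NeZero n := ⟨by omega⟩
  have := hα.isProb
  have := hσ.isProb
  have := P.isMarkovKernel_sampledChain hμ (α := α) (σ := σ)
  have := hπ.1
  have hM : 0 < ∑ l, μ l := Finset.sum_pos (fun l _ => hμ l) Finset.univ_nonempty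
  have hC : 0 < ∑ l, √(P.γ l) :=
    Finset.sum_pos (fun l _ => Real.sqrt_pos.2 (P.γ_pos l)) Finset.univ_nonempty
  have hT0 : (0 : ℝ) < T := by exact_mod_cast hT
  set κ := collapseRate n T P.γ (P.f μ) μ with hκ
  have hκ0 : 0 < κ := by rw [hκ, collapseRate]; positivity
  set K := noiseBound n T P.γ Amax Smax with hK
  have hK0 : 0 ≤ K := noiseBound_nonneg P.γ_pos _ _
  have hKs : √K ^ 2 = K := Real.sq_sqrt hK0
  have hb0 : 0 ≤ 3 / 2 * K ^ 2 / κ + √K ^ 3 := by positivity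
  have hx0 (q : Fin n → ℕ) (l : Fin n) : 0 ≤ (q l : ℝ) / P.γ l :=
    div_nonneg (Nat.cast_nonneg _) (P.γ_pos l).le
  have key := lintegral_le_of_drift_of_invariant (P.sampledChain μ α σ)
    (fun q => ENNReal.ofReal (‖perpPart P.γ q‖ ^ 3))
    (fun q => ENNReal.ofReal (3 / 2 * κ * ‖perpPart P.γ q‖ ^ 2))
    (ENNReal.ofReal (3 / 2 * K ^ 2 / κ + √K ^ 3)) (fun _ => ENNReal.ofReal_ne_top)
    (fun q => by
      obtain ⟨l₁, h₁⟩ := Finite.exists_max fun l => (q l : ℝ) / P.γ l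
      obtain ⟨l₂, h₂⟩ := Finite.exists_min fun l => (q l : ℝ) / P.γ l
      set r := ‖perpPart P.γ q‖ with hr
      have hr0 : 0 ≤ r := norm_nonneg _
      refine P.lintegral_sampledChain_add_le hμ hα hσ q (fun q => ‖perpPart P.γ q‖ ^ 3)
        (fun x => by positivity)
        (fun l => 3 * r * ((q l : ℝ) / P.γ l - meanScaledQueue P.γ q))
        (r ^ 3 + 3 * r * √K ^ 2 + √K ^ 3) _ _ (by positivity) ?_ ?_ hb0
      · filter_upwards [ae_cycleNoise_le hα hσ] with ω hω
        simp only [mul_assoc (3 * r), ← Finset.mul_sum]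
        refine cube_le_of_sq_le hr0 (P.abs_norm_perpPart_cycleStep_sub_le q ω hω) ?_
        rw [hKs]
        exact P.norm_perpPart_cycleStep_sq_le q ω hω
      · have h := P.integral_sum_mul_netInput_le hn hT hμ hα hσ hgap.le hlam
          (fun l => (q l : ℝ) / P.γ l)
          (fun l => 3 * r * ((q l : ℝ) / P.γ l - meanScaledQueue P.γ q))
          (fun v i j hij => mul_le_mul_of_nonneg_left
            (sub_le_sub_right (P.sort_antitone _ v (hx0 q) hij) _) (by positivity))
          ⟨l₁, le_rfl⟩ ⟨l₂, le_rfl⟩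
          (fun l => mul_le_mul_of_nonneg_left (sub_le_sub_right (h₂ l) _) (by positivity))
        have hIcc (l : Fin n) : (q l : ℝ) / P.γ l ∈
            Set.Icc ((q l₂ : ℝ) / P.γ l₂) ((q l₁ : ℝ) / P.γ l₁) := ⟨h₂ l, h₁ l⟩
        have hmean := meanScaledQueue_mem_Icc hn P.γ P.γ_pos q hIcc
        have hnorm := norm_perpPart_le hn P.γ P.γ_pos q hIcc
        rw [← hr] at hnorm
        set hi := (q l₁ : ℝ) / P.γ l₁ with hhi
        set lo := (q l₂ : ℝ) / P.γ l₂ with hlo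
        set x := meanScaledQueue P.γ q with hx
        set δM := majorizationGap (P.f μ) μ * ∑ l, μ l with hδM
        have hκr : κ * r ≤ T * (δM / 2) * (hi - lo) := by
          have := mul_le_mul_of_nonneg_left hnorm hκ0.le
          refine this.trans_eq ?_
          rw [hκ, collapseRate, ← hδM]
          field_simp
        -- After centring, the smallest weight is negative, so the load deficit pushes the wrong
        -- way; its smallness limits the loss to half of the majorization drift.
        have hεx : ((∑ l, μ l) - n * lam) * (x - lo) ≤ δM / 2 * (hi - lo) :=
          mul_le_mul hlam' (by linarith [hmean.2]) (sub_nonneg.2 hmean.1)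
            (by positivity)
        have h3 : T * (-δM * (3 * r * (hi - x) - 3 * r * (lo - x))
            - ((∑ l, μ l) - n * lam) * (3 * r * (lo - x))) ≤ -(3 * κ * r ^ 2) := by
          have h4 := mul_le_mul_of_nonneg_left hεx (by positivity : 0 ≤ 3 * r * T)
          have h5 := mul_le_mul_of_nonneg_left hκr (by positivity : 0 ≤ 3 * r)
          linarith
        -- Young's inequality, spending half of the quadratic drift `3κr²`.
        have h6 : 3 * r * K ≤ 3 / 2 * K ^ 2 / κ + 3 / 2 * κ * r ^ 2 := by
          have : 3 / 2 * K ^ 2 / κ + 3 / 2 * κ * r ^ 2 - 3 * r * K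
              = 3 / 2 * κ * (r - K / κ) ^ 2 := by
            field_simp
            ring
          have h7 : 0 ≤ 3 / 2 * κ * (r - K / κ) ^ 2 := by positivity
          linarith
        rw [hKs]
        linarith)
    π hπ.2
  have hκ' : 0 ≤ 3 / 2 * κ := by positivity
  simp_rw [ENNReal.ofReal_mul hκ'] at key
  rw [lintegral_const_mul _ (Measurable.of_discrete), mul_comm,
    ← ENNReal.le_div_iff_mul_le (Or.inl (by simpa using hκ0))
      (Or.inl ENNReal.ofReal_ne_top),
    ← ENNReal.ofReal_div_of_pos (by positivity)] at key
  refine key.trans (ENNReal.ofReal_le_ofReal ?_)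
  have hbound : collapseBound n T P.γ (P.F μ) μ Amax Smax = √K + K / κ := rfl
  rw [hbound]
  have e : (3 / 2 * K ^ 2 / κ + √K ^ 3) / (3 / 2 * κ)
      = (K / κ) ^ 2 + 2 / 3 * (√K * (K / κ)) := by
    rw [pow_succ (√K), hKs]
    field_simp
  rw [e]
  have h1 : 0 ≤ √K * (K / κ) := by positivity
  nlinarith [sq_nonneg (√K)]

end Drift

/-! ### Order of magnitude of the bound. -/

section Order

theorem collapseBound_bounds {γ₀ γ₁ μ₀ μ₁ θ Amax Smax : ℝ} (hγ₀ : 0 < γ₀) (hγ₁ : 0 < γ₁)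
    (hμ₀ : 0 < μ₀) (hμ₁ : 0 < μ₁) (hθ : 0 < θ) (hA : 0 < Amax) (hS : 0 < Smax) :
    ∃ c C : ℝ, 0 < c ∧ 0 < C ∧ ∀ (n T : ℕ), 1 ≤ n → 1 ≤ T → ∀ (P : Policy n T) (μ : Fin n → ℝ),
      (∀ l, P.γ l ∈ Set.Icc γ₀ γ₁) → (∀ l, μ l ∈ Set.Icc μ₀ μ₁) →
      P.MajorizationSlack μ (θ / n) →
      c * (T * (n : ℝ) ^ 4) ≤ collapseBound n T P.γ (P.F μ) μ Amax Smax ∧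
      collapseBound n T P.γ (P.F μ) μ Amax Smax ≤ C * (T * (n : ℝ) ^ 4) := by
  have hθ' : 0 < min θ 1 := lt_min hθ one_pos
  have hB : 0 < 2 * Amax ^ 2 + Smax ^ 2 := by positivity
  have hs₀ := Real.sqrt_pos.2 hγ₀
  have hs₁ := Real.sqrt_pos.2 hγ₁
  refine ⟨γ₁⁻¹ * (2 * Amax ^ 2) * (2 * √γ₀) / μ₁,
    √(γ₀⁻¹ * (2 * Amax ^ 2 + Smax ^ 2))
      + γ₀⁻¹ * (2 * Amax ^ 2 + Smax ^ 2) * (2 * √γ₁) / (min θ 1 * μ₀),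
    by positivity, by positivity, fun n T hn hT P μ hγ hμ hslack => ?_⟩
  have hn1 : (1 : ℝ) ≤ n := by exact_mod_cast hn
  have hn0 : (0 : ℝ) < n := by linarith
  have hT0 : (0 : ℝ) < T := by exact_mod_cast hT
  set K := noiseBound n T P.γ Amax Smax with hK
  set κ := collapseRate n T P.γ (P.f μ) μ with hκ
  have hbound : collapseBound n T P.γ (P.F μ) μ Amax Smax = √K + K / κ := rfl
  have card_le (g : Fin n → ℝ) (b : ℝ) (h : ∀ l, g l ≤ b) : ∑ l, g l ≤ n * b := by
    simpa using Finset.sum_le_sum fun l (_ : l ∈ Finset.univ) => h l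
  have le_card (g : Fin n → ℝ) (b : ℝ) (h : ∀ l, b ≤ g l) : n * b ≤ ∑ l, g l := by
    simpa using Finset.sum_le_sum fun l (_ : l ∈ Finset.univ) => h l
  have g1 : n * γ₁⁻¹ ≤ ∑ l, (P.γ l)⁻¹ :=
    le_card _ _ fun l => inv_anti₀ (P.γ_pos l) (hγ l).2
  have g2 : ∑ l, (P.γ l)⁻¹ ≤ n * γ₀⁻¹ := card_le _ _ fun l => inv_anti₀ hγ₀ (hγ l).1
  have s1 : n * √γ₀ ≤ ∑ l, √(P.γ l) := le_card _ _ fun l => Real.sqrt_le_sqrt (hγ l).1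
  have s2 : ∑ l, √(P.γ l) ≤ n * √γ₁ := card_le _ _ fun l => Real.sqrt_le_sqrt (hγ l).2
  have m1 : n * μ₀ ≤ ∑ l, μ l := le_card _ _ fun l => (hμ l).1
  have m2 : ∑ l, μ l ≤ n * μ₁ := card_le _ _ fun l => (hμ l).2
  have d1 : min θ 1 / n ≤ majorizationGap (P.f μ) μ := hslack.le_majorizationGap
  have d2 : majorizationGap (P.f μ) μ ≤ 1 / n := majorizationGap_le_one_div _ _
  have hM : 0 < ∑ l, μ l := lt_of_lt_of_le (by positivity) m1
  have hδ : 0 < majorizationGap (P.f μ) μ := lt_of_lt_of_le (by positivity) d1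
  have hC : 0 < ∑ l, √(P.γ l) := lt_of_lt_of_le (by positivity) s1
  have hκ0 : 0 < κ := by rw [hκ, collapseRate]; positivity
  -- Here `δ` has order `1/n` and `∑ μ` has order `n`, so their product has order one and `κ` has
  -- order `T/n`.
  have κ1 : κ ≤ T * μ₁ / (2 * (n * √γ₀)) := by
    rw [hκ, collapseRate]
    have : majorizationGap (P.f μ) μ * ∑ l, μ l ≤ μ₁ := by
      refine (mul_le_mul d2 m2 hM.le (by positivity)).trans_eq ?_
      field_simp
    gcongr
  have κ2 : T * (min θ 1 * μ₀) / (2 * (n * √γ₁)) ≤ κ := by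
    rw [hκ, collapseRate]
    have : min θ 1 * μ₀ ≤ majorizationGap (P.f μ) μ * ∑ l, μ l := by
      calc min θ 1 * μ₀ = min θ 1 / n * (n * μ₀) := by field_simp
        _ ≤ _ := mul_le_mul d1 m1 (by positivity) hδ.le
    gcongr
  have K1 : T ^ 2 * (n * γ₁⁻¹) * (2 * (n * Amax) ^ 2) ≤ K := by
    rw [hK, noiseBound]
    have hg0 : 0 ≤ ∑ l, (P.γ l)⁻¹ := le_trans (by positivity) g1
    gcongr
    exact le_add_of_nonneg_right (by positivity)
  have K2 : K ≤ T ^ 2 * n ^ 3 * (γ₀⁻¹ * (2 * Amax ^ 2 + Smax ^ 2)) := by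
    have hn2 : (n : ℝ) * Smax ^ 2 ≤ n ^ 2 * Smax ^ 2 := by
      gcongr
      nlinarith
    calc K ≤ T ^ 2 * (n * γ₀⁻¹) * (2 * (n * Amax) ^ 2 + n ^ 2 * Smax ^ 2) := by
          rw [hK, noiseBound]
          gcongr
      _ = _ := by ring
  have hK0 : 0 ≤ K := le_trans (by positivity) K1
  rw [hbound]
  constructor
  -- The arrival part of `K` alone yields the lower bound.
  · calc _ = T ^ 2 * (n * γ₁⁻¹) * (2 * (n * Amax) ^ 2) / (T * μ₁ / (2 * (n * √γ₀))) := by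
          field_simp
      _ ≤ K / κ := by gcongr
      _ ≤ √K + K / κ := le_add_of_nonneg_left (Real.sqrt_nonneg _)
  · rw [add_mul]
    refine add_le_add ?_ ?_
    -- `√K` has order at most `T n^(3/2)`; it is absorbed since `n³ ≤ n⁸` under the square.
    · refine Real.sqrt_le_iff.2 ⟨by positivity, K2.trans ?_⟩
      rw [mul_pow, Real.sq_sqrt (by positivity), mul_comm]
      refine mul_le_mul_of_nonneg_left ?_ (by positivity)
      rw [mul_pow, ← pow_mul]
      gcongr
      norm_num
    · calc K / κ ≤ T ^ 2 * n ^ 3 * (γ₀⁻¹ * (2 * Amax ^ 2 + Smax ^ 2))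
            / (T * (min θ 1 * μ₀) / (2 * (n * √γ₁))) := by gcongr
        _ = _ := by field_simp

end Order

end LoadBalancing

theorem theorem3 :
    ∃ N : (n : ℕ) → (T : ℕ) → (γ : Fin n → ℝ) →
        (F : Equiv.Perm (Fin n) → (Fin n → ℝ) × (Fin n → ℝ)) →
        (μ : Fin n → ℝ) → (Amax Smax : ℝ) → ℝ,
      -- the second moment of the perpendicular component in steady state
      (∀ (n T : ℕ), 1 ≤ n → 1 ≤ T →
        ∀ (P : LoadBalancing.Policy n T) (μ : Fin n → ℝ) (Amax Smax : ℝ),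
          (∀ l, 0 < μ l) → P.StrictMajorization μ →
          ∃ ε₀ : ℝ, 0 < ε₀ ∧
            ∀ (lam : ℝ) (α : MeasureTheory.Measure ℕ) (σ : MeasureTheory.Measure (Fin n → ℕ)),
              LoadBalancing.IsArrivalLaw n lam Amax α →
              LoadBalancing.IsServiceLaw μ Smax σ →
              0 < (∑ l, μ l) - n * lam → (∑ l, μ l) - n * lam < ε₀ →
              (∃ π, P.IsSteadyState μ α σ π) ∧
              ∀ π, P.IsSteadyState μ α σ π →
                MeasureTheory.Integrable (fun q => ‖LoadBalancing.perpPart P.γ q‖ ^ 2) π ∧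
                ∫ q, ‖LoadBalancing.perpPart P.γ q‖ ^ 2 ∂π
                  ≤ N n T P.γ (P.F μ) μ Amax Smax ^ 2) ∧
      -- the order of magnitude of the bound
      (∀ (γ₀ γ₁ μ₀ μ₁ θ Amax Smax : ℝ),
        0 < γ₀ → 0 < γ₁ → 0 < μ₀ → 0 < μ₁ → 0 < θ → 0 < Amax → 0 < Smax →
        ∃ c C : ℝ, 0 < c ∧ 0 < C ∧
          ∀ (n T : ℕ), 1 ≤ n → 1 ≤ T →
            ∀ (P : LoadBalancing.Policy n T) (μ : Fin n → ℝ),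
              (∀ l, P.γ l ∈ Set.Icc γ₀ γ₁) → (∀ l, μ l ∈ Set.Icc μ₀ μ₁) →
              P.MajorizationSlack μ (θ / n) →
              c * (T * (n : ℝ) ^ 4) ≤ N n T P.γ (P.F μ) μ Amax Smax ∧
              N n T P.γ (P.F μ) μ Amax Smax ≤ C * (T * (n : ℝ) ^ 4)) := by
  refine ⟨LoadBalancing.collapseBound, ?_, ?_⟩
  · intro n T hn hT P μ Amax Smax hμ hmaj
    have : NeZero n := ⟨by omega⟩
    have hM : 0 < ∑ l, μ l := Finset.sum_pos (fun l _ => hμ l) Finset.univ_nonempty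
    have hgap := hmaj.majorizationGap_pos hn
    -- The threshold `δM/2` depends only on the policy and the rates, hence is uniform over the
    -- arrival and service laws.
    refine ⟨LoadBalancing.majorizationGap (P.f μ) μ * (∑ l, μ l) / 2, by positivity, ?_⟩
    intro lam α σ hα hσ hε hε'
    refine ⟨P.exists_isSteadyState hn hT hμ hα hσ hgap (sub_pos.1 hε), fun π hπ => ?_⟩
    have h := P.lintegral_norm_perpPart_sq_le hn hT hμ hα hσ hgap (sub_pos.1 hε).le hε'.le hπ
    have hnn : 0 ≤ᵐ[π] fun q => ‖LoadBalancing.perpPart P.γ q‖ ^ 2 :=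
      .of_forall fun q => sq_nonneg _
    have hmeas : AEStronglyMeasurable (fun q => ‖LoadBalancing.perpPart P.γ q‖ ^ 2) π :=
      (Measurable.of_discrete).aestronglyMeasurable
    refine ⟨⟨hmeas, (hasFiniteIntegral_iff_ofReal hnn).2 (h.trans_lt ENNReal.ofReal_lt_top)⟩, ?_⟩
    rw [integral_eq_lintegral_of_nonneg_ae hnn hmeas]
    exact ENNReal.toReal_le_of_le_ofReal (sq_nonneg _) h
  · intro γ₀ γ₁ μ₀ μ₁ θ Amax Smax hγ₀ hγ₁ hμ₀ hμ₁ hθ hA hS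
    exact LoadBalancing.collapseBound_bounds hγ₀ hγ₁ hμ₀ hμ₁ hθ hA hS
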